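/- **Conventions.** A finite metric graph has finitely many vertices and edges, and each edge $e$ is identified with a segment $[0,l_e]$, $l_e>0$; loops and parallel edges are allowed, and the graph is *simple* if it has none. Let $d_v$ be the number of edge ends at the vertex $v$. A *generalized quantum graph* $\Gamma$ is a finite metric graph with, at every vertex $v$, a boundary condition $A_v f|_v+B_v f'|_v=0$. Here $f|_v$ is the vector of the values and $f'|_v$ the vector of the outgoing derivatives of $f$ at the edge ends at $v$, and $A_v,B_v$ are complex matrices of the same size, with $d_v$ columns and finitely many rows. It is *proper* if all $A_v,B_v$ are $d_v\times d_v$, and *exact* if $\mathrm{rank}(A_v\,|\,B_v)=d_v$ for all $v$. Let $C^\infty(\Gamma)$ be the space of families of functions $f|_e\in C^\infty([0,l_e],\mathbb C)$ that satisfy the boundary conditions, and let $\mathcal H(\Gamma)\subseteq C^\infty(\Gamma)$ be the span of the $f\in C^\infty(\Gamma)$ with $-f''=\lambda f$ for some $\lambda\in\mathbb C$. It is a $\mathbb C[x]$-module, $x$ acting as $-\Delta f=-f''$. The Laplacian of $\Gamma$ is *self-adjoint* if the closure in $\bigoplus_e L^2([0,l_e])$ of $-\Delta$ with domain $C^\infty(\Gamma)$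 is self-adjoint. A group $G$ acts on $\Gamma$ if it acts on the vertices and on the edge ends (hence on the edges), preserving incidence, lengths and boundary conditions; then $\mathcal H(\Gamma)$ is a representation of $G$ by $gf=f\circ g^{-1}$. For a representation $R$ of $G$, $\mathrm{Hom}_{\mathbb CG}(R,\mathcal H(\Gamma))$ is a $\mathbb C[x]$-module by $(x\tilde f)(r)=-\Delta(\tilde f(r))$. A *$\Gamma/R$-graph* is a generalized quantum graph $\Gamma'$ with $\mathcal H(\Gamma')\cong\mathrm{Hom}_{\mathbb CG}(R,\mathcal H(\Gamma))$ as $\mathbb C[x]$-modules. **Theorem.** Let $G$ be a finite group acting on a generalized quantum graph $\Gamma$, and let $R$ be a complex representation of $G$ of finite dimension $d$, with structure map $\rho$. 1. There is a generalized quantum graph, which is simple, that is a $\Gamma/R$-graph. 2. If $\Gamma$ is proper and its Laplacian is self-adjoint, then there is a simple $\Gamma/R$-graph which is proper and exact. 3. For an edge $e$ let $G_e$ be its stabilizer and $d_e=\dim R^{G_e}$. The following choices can be made: representatives for the $G$-orbits of vertices and of edges; for every edge $e$, with $\tilde e$ the representative of its orbit, some $g_e\in G$ with $g_e\tilde e=e$;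 an ordered basis $B$ of $R$; and for every representative edge $\tilde e$ an ordered basis $B^{\tilde e}=(b^{\tilde e}_j)_{j=1}^d$ of $R$ such that $b^{\tilde e}_j\in R^{G_{\tilde e}}$ for $j\le d_{\tilde e}$, while for $j>d_{\tilde e}$ the vector $b^{\tilde e}_j$ lies in the sum of the nontrivial components of $\mathrm{Res}_{G_{\tilde e}}R$, that is, in the span of the $hr-r$ with $h\in G_{\tilde e}$, $r\in R$. For any such choices let $Q$ be the following generalized quantum graph. Its vertices are the representative vertices of $\Gamma$. Its edges are the pairs $(\tilde e,j)$ with $\tilde e$ a representative edge and $1\le j\le d_{\tilde e}$, of length $l_{\tilde e}$, whose ends lie at the representatives of the end vertices of $\tilde e$. Its matrices at a representative vertex $v$ are $$(A_v\otimes I_d)\,\mathfrak G\,\Theta\quad\text{and}\quad(B_v\otimes I_d)\,\mathfrak G\,\Theta .$$ Here $\mathfrak G$ is the transpose of the block diagonal matrix with, for each edge end at $v$ in $\Gamma$, belonging to an edge $e$, the block $[\rho(g_e^{-1})]^{B}_{B^{\tilde e}}$, the matrix of $\rho(g_e^{-1})$ from $B$-coordinates to $B^{\tilde e}$-coordinates.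 The matrix $\Theta$ has its rows indexed by the pairs (edge end at $v$ in $\Gamma$, index $i\le d$) and its columns by the edge ends at $v$ in $Q$; its entry in the row of an end of $e$ and $i$, and the column of an end of $(\tilde e',j)$, is $1$ if $\tilde e=\tilde e'$ and $i=j$, and $0$ otherwise. Suppose that no element of $G$ carries an end vertex of an edge to the other end vertex of that edge (in particular there are no loops). Then $Q$ is a $\Gamma/R$-graph: the formula $$(\Psi\tilde f)|_{(\tilde e,j)}=\tilde f(b^{\tilde e}_j)|_{\tilde e}$$ defines an isomorphism of $\mathbb C[x]$-modules $\Psi:\mathrm{Hom}_{\mathbb CG}(R,\mathcal H(\Gamma))\to\mathcal H(Q)$. If moreover $\Gamma$ is proper and its Laplacian is self-adjoint, then $Q$ is exact. -/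

import Mathlib

open MeasureTheory Set
open scoped ContDiff Polynomial Kronecker

universe u v w

/-- A finite metric graph. The edge `e` is identified with the segment `[0, len e]`; its two ends
are the pairs `(e, false)` (the end with coordinate `0`) and `(e, true)` (the end with coordinate
`len e`), and `endpt` gives the vertex at which each end lies. Loops and parallel edges are allowed
here; see `MetricGraph.IsSimple`. -/
structure MetricGraph where
  V : Type u
  E : Type u
  finite_V : Finite V
  finite_E : Finite E
  endpt : E × Bool → V
  len : E → ℝ
  len_pos : ∀ e, 0 < len e

namespace MetricGraph

variable (Γ : MetricGraph.{u})

/-- The other end of the same edge. -/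
def flip {E : Type u} (d : E × Bool) : E × Bool := (d.1, !d.2)

/-- The edge ends lying at the vertex `x`. In a graph without loops these are the edges incident
to `x`. -/
def EndsAt (x : Γ.V) : Type u := {d : Γ.E × Bool // Γ.endpt d = x}

noncomputable instance : Fintype Γ.E := @Fintype.ofFinite _ Γ.finite_E

noncomputable instance (x : Γ.V) : Fintype (Γ.EndsAt x) :=
  @Fintype.ofFinite _ (by
    have := Γ.finite_E
    unfold EndsAt
    infer_instance)

noncomputable instance (x : Γ.V) : DecidableEq (Γ.EndsAt x) := Classical.decEq _

/-- The degree of a vertex. -/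
noncomputable def degree (x : Γ.V) : ℕ := Nat.card (Γ.EndsAt x)

/-- There are no loops and no parallel edges. -/
def IsSimple : Prop :=
  (∀ e, Γ.endpt (e, false) ≠ Γ.endpt (e, true)) ∧
  (∀ e e', s(Γ.endpt (e, false), Γ.endpt (e, true)) = s(Γ.endpt (e', false), Γ.endpt (e', true)) →
    e = e')

/-- The segment `[0, len e]`. -/
def seg (e : Γ.E) : Set ℝ := Icc 0 (Γ.len e)

/-- The coordinate on the edge of `d` of the point at distance `t` from the end `d`. -/
def coord (d : Γ.E × Bool) (t : ℝ) : ℝ := if d.2 then Γ.len d.1 - t else t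

/-- The smooth functions on the graph: a family of functions `f e` on the segments
`[0, len e]`, each smooth up to the boundary. A function on `[0, len e]` is represented by its
extension by zero to the real line. -/
def Smooth : Submodule ℂ (Γ.E → ℝ → ℂ) where
  carrier := {f | ∀ e, ContDiffOn ℝ ∞ (f e) (Γ.seg e) ∧ ∀ t, t ∉ Γ.seg e → f e t = 0}
  add_mem' := by
    intro f g hf hg e
    exact ⟨(hf e).1.add (hg e).1, fun t ht => by simp [(hf e).2 t ht, (hg e).2 t ht]⟩
  zero_mem' := fun e => ⟨contDiffOn_const, fun t _ => rfl⟩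
  smul_mem' := by
    intro c f hf e
    exact ⟨(hf e).1.const_smul c, fun t ht => by simp [(hf e).2 t ht]⟩

/-- The function `f`, on the edge of `d`, as a function of the distance from the end `d`. -/
def along (f : Γ.E → ℝ → ℂ) (d : Γ.E × Bool) : ℝ → ℂ := fun t => f d.1 (Γ.coord d t)

/-- The value of `f` at the end `d` of an edge. -/
def value (f : Γ.E → ℝ → ℂ) (d : Γ.E × Bool) : ℂ := Γ.along f d 0

/-- The outgoing derivative of `f` at the end `d` of an edge. -/
noncomputable def outDeriv (f : Γ.E → ℝ → ℂ) (d : Γ.E × Bool) : ℂ :=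
  derivWithin (Γ.along f d) (Γ.seg d.1) 0

theorem uniqueDiffOn_seg (e : Γ.E) : UniqueDiffOn ℝ (Γ.seg e) := uniqueDiffOn_Icc (Γ.len_pos e)

theorem zero_mem_seg (e : Γ.E) : (0 : ℝ) ∈ Γ.seg e := ⟨le_rfl, (Γ.len_pos e).le⟩

theorem coord_mem_seg (d : Γ.E × Bool) (t : ℝ) : Γ.coord d t ∈ Γ.seg d.1 ↔ t ∈ Γ.seg d.1 := by
  unfold coord seg
  split_ifs
  · simp only [mem_Icc]
    constructor <;> rintro ⟨h₁, h₂⟩ <;> constructor <;> linarith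
  · rfl

theorem contDiff_coord (d : Γ.E × Bool) : ContDiff ℝ ∞ (Γ.coord d) := by
  unfold coord
  cases d.2
  · exact contDiff_id
  · simpa using contDiff_const.sub contDiff_id

theorem contDiffOn_along (f : Γ.Smooth) (d : Γ.E × Bool) :
    ContDiffOn ℝ ∞ (Γ.along f.1 d) (Γ.seg d.1) :=
  (f.2 d.1).1.comp (Γ.contDiff_coord d).contDiffOn fun t ht => (Γ.coord_mem_seg d t).2 ht

theorem along_flip (f : Γ.E → ℝ → ℂ) (d : Γ.E × Bool) (t : ℝ) :
    Γ.along f (flip d) t = Γ.along f d (Γ.len d.1 - t) := by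
  rcases d with ⟨e, _ | _⟩ <;> simp [along, flip, coord]

theorem along_add (f g : Γ.E → ℝ → ℂ) (d : Γ.E × Bool) :
    Γ.along (f + g) d = Γ.along f d + Γ.along g d := rfl

theorem along_smul (c : ℂ) (f : Γ.E → ℝ → ℂ) (d : Γ.E × Bool) :
    Γ.along (c • f) d = c • Γ.along f d := rfl

theorem differentiableWithinAt_along (f : Γ.Smooth) (d : Γ.E × Bool) {t : ℝ}
    (ht : t ∈ Γ.seg d.1) : DifferentiableWithinAt ℝ (Γ.along f.1 d) (Γ.seg d.1) t :=
  (Γ.contDiffOn_along f d).differentiableOn (by simp) t ht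

theorem value_add (f g : Γ.E → ℝ → ℂ) : Γ.value (f + g) = Γ.value f + Γ.value g := rfl

theorem value_smul (c : ℂ) (f : Γ.E → ℝ → ℂ) : Γ.value (c • f) = c • Γ.value f := rfl

theorem outDeriv_add (f g : Γ.Smooth) :
    Γ.outDeriv (f.1 + g.1) = Γ.outDeriv f.1 + Γ.outDeriv g.1 := by
  ext d
  exact derivWithin_add (Γ.differentiableWithinAt_along f d (Γ.zero_mem_seg _))
    (Γ.differentiableWithinAt_along g d (Γ.zero_mem_seg _))

theorem outDeriv_smul (c : ℂ) (f : Γ.Smooth) : Γ.outDeriv (c • f.1) = c • Γ.outDeriv f.1 := by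
  ext d
  exact derivWithin_const_smul c (Γ.differentiableWithinAt_along f d (Γ.zero_mem_seg _))

/-- The second derivative along each edge. -/
noncomputable def secondDeriv (f : Γ.E → ℝ → ℂ) (e : Γ.E) : ℝ → ℂ :=
  derivWithin (derivWithin (f e) (Γ.seg e)) (Γ.seg e)

theorem contDiffOn_derivWithin {s : Set ℝ} (hs : UniqueDiffOn ℝ s) {h : ℝ → ℂ}
    (hh : ContDiffOn ℝ ∞ h s) : ContDiffOn ℝ ∞ (derivWithin h s) s :=
  ((contDiffOn_infty_iff_derivWithin hs).1 hh).2

/-- The negative Laplacian `f ↦ -f''` on smooth functions. -/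
noncomputable def laplacian : Module.End ℂ Γ.Smooth where
  toFun f := ⟨fun e => (Γ.seg e).indicator fun t => -Γ.secondDeriv f.1 e t, by
    intro e
    refine ⟨?_, fun t ht => indicator_of_notMem ht _⟩
    have h := (contDiffOn_derivWithin (Γ.uniqueDiffOn_seg e)
      (contDiffOn_derivWithin (Γ.uniqueDiffOn_seg e) (f.2 e).1)).neg
    exact h.congr fun t ht => indicator_of_mem ht _⟩
  map_add' f g := by
    ext e t
    by_cases ht : t ∈ Γ.seg e
    · have hd : ∀ k : Γ.Smooth, DifferentiableOn ℝ (k.1 e) (Γ.seg e) := fun k =>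
        (k.2 e).1.differentiableOn (by simp)
      have hd' : ∀ k : Γ.Smooth, DifferentiableOn ℝ (derivWithin (k.1 e) (Γ.seg e)) (Γ.seg e) :=
        fun k => (contDiffOn_derivWithin (Γ.uniqueDiffOn_seg e) (k.2 e).1).differentiableOn
          (by simp)
      have h1 : ∀ x ∈ Γ.seg e, derivWithin (f.1 e + g.1 e) (Γ.seg e) x =
          (derivWithin (f.1 e) (Γ.seg e) + derivWithin (g.1 e) (Γ.seg e)) x := fun x hx =>
        derivWithin_add (hd f x hx) (hd g x hx)
      have h2 : Γ.secondDeriv (f.1 + g.1) e t = Γ.secondDeriv f.1 e t + Γ.secondDeriv g.1 e t := by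
        unfold secondDeriv
        rw [Pi.add_apply, derivWithin_congr h1 (h1 t ht)]
        exact derivWithin_add (hd' f t ht) (hd' g t ht)
      simp only [Submodule.coe_add, Pi.add_apply, indicator_of_mem ht, h2]
      ring
    · simp [indicator_of_notMem ht]
  map_smul' c f := by
    ext e t
    by_cases ht : t ∈ Γ.seg e
    · have hd : DifferentiableOn ℝ (f.1 e) (Γ.seg e) := (f.2 e).1.differentiableOn (by simp)
      have hd' : DifferentiableOn ℝ (derivWithin (f.1 e) (Γ.seg e)) (Γ.seg e) :=
        (contDiffOn_derivWithin (Γ.uniqueDiffOn_seg e) (f.2 e).1).differentiableOn (by simp)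
      have h1 : ∀ x ∈ Γ.seg e, derivWithin (c • f.1 e) (Γ.seg e) x =
          (c • derivWithin (f.1 e) (Γ.seg e)) x := fun x hx =>
        derivWithin_const_smul c (hd x hx)
      have h2 : Γ.secondDeriv (c • f.1) e t = c • Γ.secondDeriv f.1 e t := by
        unfold secondDeriv
        rw [Pi.smul_apply, derivWithin_congr h1 (h1 t ht)]
        exact derivWithin_const_smul c (hd' t ht)
      simp only [Submodule.coe_smul, Pi.smul_apply, indicator_of_mem ht, h2, RingHom.id_apply,
        smul_neg]
    · simp [indicator_of_notMem ht]

/-- The Hilbert space `L²` of the graph, with inner product `∑ e, ∫ conj (f e) * g e`. -/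
abbrev L2 : Type u := PiLp 2 fun e : Γ.E => Lp ℂ 2 (volume.restrict (Γ.seg e))

theorem memLp_smooth (f : Γ.Smooth) (e : Γ.E) : MemLp (f.1 e) 2 (volume.restrict (Γ.seg e)) := by
  have hc : ContinuousOn (f.1 e) (Γ.seg e) := (f.2 e).1.continuousOn
  have : IsFiniteMeasure (volume.restrict (Γ.seg e)) := ⟨by simp [MetricGraph.seg]⟩
  obtain ⟨M, hM⟩ := isCompact_Icc.exists_bound_of_continuousOn hc
  exact MemLp.of_bound (hc.aestronglyMeasurable measurableSet_Icc) M
    ((ae_restrict_iff' measurableSet_Icc).2 (Filter.Eventually.of_forall hM))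

/-- Smooth functions as elements of `L²`. -/
noncomputable def toL2 : Γ.Smooth →ₗ[ℂ] Γ.L2 where
  toFun f := WithLp.toLp 2 fun e => (Γ.memLp_smooth f e).toLp (f.1 e)
  map_add' _ _ := rfl
  map_smul' _ _ := rfl

theorem toL2_injective : Function.Injective Γ.toL2 := by
  intro f g h
  ext e t
  by_cases ht : t ∈ Γ.seg e
  · have h1 : (Γ.memLp_smooth f e).toLp (f.1 e) = (Γ.memLp_smooth g e).toLp (g.1 e) :=
      congrFun (congrArg WithLp.ofLp h) e
    rw [MemLp.toLp_eq_toLp_iff] at h1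
    exact Measure.eqOn_Icc_of_ae_eq volume (Γ.len_pos e).ne h1 (f.2 e).1.continuousOn
      (g.2 e).1.continuousOn ht
  · rw [(f.2 e).2 t ht, (g.2 e).2 t ht]

end MetricGraph

/-- A generalized quantum graph: a metric graph with, at each vertex `x`, homogeneous boundary
conditions `A x * f(x) + B x * f'(x) = 0`, where the complex matrices `A x` and `B x` have one
column for every edge end at `x` and finitely many rows. -/
structure QuantumGraph extends MetricGraph.{u} where
  Row : V → Type
  finite_Row : ∀ x, Finite (Row x)
  A : ∀ x, Matrix (Row x) (toMetricGraph.EndsAt x) ℂ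
  B : ∀ x, Matrix (Row x) (toMetricGraph.EndsAt x) ℂ

namespace QuantumGraph

variable (Γ : QuantumGraph.{u})

/-- A proper quantum graph: the matrices at `x` are square, of size the degree of `x`. -/
def IsProper : Prop := ∀ x, Nat.card (Γ.Row x) = Γ.degree x

/-- The rank of the block matrix `(A x | B x)`. -/
noncomputable def rankAt (x : Γ.V) : ℕ := (Matrix.fromCols (Γ.A x) (Γ.B x)).rank

/-- At each vertex the matrix `(A x | B x)` has rank the degree of the vertex. For a proper quantum
graph this says that these matrices are of full rank. -/
def IsExact : Prop := ∀ x, Γ.rankAt x = Γ.degree x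

/-- The boundary condition at `x`, for a family `a` of values and a family `b` of outgoing
derivatives at the edge ends. -/
def BoundaryCondition (x : Γ.V) (a b : Γ.E × Bool → ℂ) : Prop :=
  Matrix.mulVec (Γ.A x) (fun d => a d.1) + Matrix.mulVec (Γ.B x) (fun d => b d.1) = 0

/-- `C^∞(Γ)`: the smooth functions which satisfy the boundary conditions at all vertices. -/
noncomputable def SmoothBC : Submodule ℂ Γ.Smooth where
  carrier := {f | ∀ x, Γ.BoundaryCondition x (Γ.value f.1) (Γ.outDeriv f.1)}
  add_mem' := by
    intro f g hf hg x
    have h := congrArg₂ (· + ·) (hf x) (hg x)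
    simp only [add_zero] at h
    refine Eq.trans ?_ h
    simp only [Submodule.coe_add, MetricGraph.value_add, MetricGraph.outDeriv_add, Pi.add_apply]
    have e1 : ∀ p q : Γ.E × Bool → ℂ, (fun d : Γ.EndsAt x => p d.1 + q d.1) =
      (fun d => p d.1) + fun d => q d.1 := fun _ _ => rfl
    rw [e1, e1, Matrix.mulVec_add, Matrix.mulVec_add]
    abel
  zero_mem' := by
    intro x
    have h1 : Γ.value ((0 : Γ.Smooth) : Γ.E → ℝ → ℂ) = 0 := rfl
    have h2 : Γ.outDeriv ((0 : Γ.Smooth) : Γ.E → ℝ → ℂ) = 0 := by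
      have h := Γ.outDeriv_smul 0 0
      simpa using h
    rw [h1, h2]
    have e1 : (fun d : Γ.EndsAt x => (0 : Γ.E × Bool → ℂ) d.1) = 0 := rfl
    simp only [BoundaryCondition, e1, Matrix.mulVec_zero, add_zero]
  smul_mem' := by
    intro c f hf x
    have h := congrArg (c • ·) (hf x)
    simp only [smul_zero] at h
    refine Eq.trans ?_ h
    simp only [Submodule.coe_smul, MetricGraph.value_smul, MetricGraph.outDeriv_smul,
      Pi.smul_apply]
    have e1 : ∀ p : Γ.E × Bool → ℂ, (fun d : Γ.EndsAt x => c • p d.1) =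
      c • fun d : Γ.EndsAt x => p d.1 := fun _ => rfl
    rw [e1, e1, Matrix.mulVec_smul, Matrix.mulVec_smul, smul_add]

/-- The eigenspace `Φ_Γ(μ) = {f ∈ C^∞(Γ) | -f'' = μ f}`. -/
noncomputable def Eig (μ : ℂ) : Submodule ℂ Γ.Smooth :=
  Γ.SmoothBC ⊓ Module.End.eigenspace Γ.laplacian μ

/-- `H(Γ)`: the span of the eigenfunctions of the Laplacian in `C^∞(Γ)`. -/
noncomputable def H : Submodule ℂ Γ.Smooth := ⨆ μ : ℂ, Γ.Eig μ

theorem laplacian_mem_H : ∀ f ∈ Γ.H, Γ.laplacian f ∈ Γ.H := by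
  change Γ.H ≤ Γ.H.comap Γ.laplacian
  refine iSup_le fun μ f hf => ?_
  have h : Γ.laplacian f = μ • f := Module.End.mem_eigenspace_iff.1 hf.2
  rw [Submodule.mem_comap, h]
  exact Submodule.smul_mem _ _ (le_iSup Γ.Eig μ hf)

/-- The negative Laplacian as an operator on `H(Γ)`. -/
noncomputable def laplacianH : Module.End ℂ Γ.H := Γ.laplacian.restrict Γ.laplacian_mem_H

/-- The negative Laplacian as an unbounded operator in `L²(Γ)` with domain `C^∞(Γ)`. -/
noncomputable def laplacianL2 : Γ.L2 →ₗ.[ℂ] Γ.L2 where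
  domain := Γ.SmoothBC.map Γ.toL2
  toFun := Γ.toL2 ∘ₗ Γ.laplacian ∘ₗ Γ.SmoothBC.subtype ∘ₗ
    (Γ.SmoothBC.equivMapOfInjective Γ.toL2 Γ.toL2_injective).symm.toLinearMap

/-- The Laplacian is self-adjoint in `L²(Γ)`: the closure of the negative Laplacian with domain
`C^∞(Γ)` is a self-adjoint unbounded operator. -/
def LaplacianIsSelfAdjoint : Prop := IsSelfAdjoint Γ.laplacianL2.closure

/-- An action of a group `G` by symmetries of the quantum graph `Γ`: `G` permutes the vertices and
the edge ends, compatibly with the incidence relations, preserves the lengths of edges, and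
preserves the boundary conditions. For a graph without loops the action on edge ends amounts to
an action on edges. -/
structure Action (G : Type v) [Group G] (Γ : QuantumGraph.{u}) where
  onV : G →* Equiv.Perm Γ.V
  onEnds : G →* Equiv.Perm (Γ.E × Bool)
  onEnds_flip : ∀ g d, onEnds g (MetricGraph.flip d) = MetricGraph.flip (onEnds g d)
  endpt_onEnds : ∀ g d, Γ.endpt (onEnds g d) = onV g (Γ.endpt d)
  len_onEnds : ∀ g d, Γ.len (onEnds g d).1 = Γ.len d.1
  boundaryCondition_iff : ∀ g x a b, Γ.BoundaryCondition (onV g x) a b ↔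
    Γ.BoundaryCondition x (fun d => a (onEnds g d)) (fun d => b (onEnds g d))

namespace Action

variable {G : Type v} [Group G] {Γ} (act : Γ.Action G)

/-- The image of the edge `e` under `g`. -/
def onE (g : G) (e : Γ.E) : Γ.E := (act.onEnds g (e, false)).1

/-- The function `g f = f ∘ g⁻¹`: the point of the edge `e` with coordinate `t` is the point at
distance `t` from the end `(e, false)`, which `g⁻¹` maps to the point at distance `t` from the image
of that end. -/
def transport (g : G) (f : Γ.E → ℝ → ℂ) : Γ.E → ℝ → ℂ :=
  fun e t => Γ.along f (act.onEnds g⁻¹ (e, false)) t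

theorem seg_onEnds (g : G) (d : Γ.E × Bool) : Γ.seg (act.onEnds g d).1 = Γ.seg d.1 := by
  unfold MetricGraph.seg
  rw [act.len_onEnds]

theorem along_transport (g : G) (f : Γ.E → ℝ → ℂ) (d : Γ.E × Bool) :
    Γ.along (act.transport g f) d = Γ.along f (act.onEnds g⁻¹ d) := by
  rcases d with ⟨e, _ | _⟩
  · rfl
  · ext t
    have h : act.onEnds g⁻¹ (e, true) = MetricGraph.flip (act.onEnds g⁻¹ (e, false)) :=
      act.onEnds_flip g⁻¹ (e, false)
    rw [h, Γ.along_flip, act.len_onEnds]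
    rfl

theorem transport_apply (g : G) (f : Γ.E → ℝ → ℂ) (e : Γ.E) :
    act.transport g f e = Γ.along f (act.onEnds g⁻¹ (e, false)) := rfl

theorem transport_mem (g : G) (f : Γ.Smooth) : act.transport g f.1 ∈ Γ.Smooth := by
  intro e
  have hs : Γ.seg (act.onEnds g⁻¹ (e, false)).1 = Γ.seg e := act.seg_onEnds g⁻¹ (e, false)
  refine ⟨?_, fun t ht => ?_⟩
  · have h := Γ.contDiffOn_along f (act.onEnds g⁻¹ (e, false))
    rwa [hs] at h
  · rw [← hs] at ht
    exact (f.2 _).2 _ fun h => ht ((Γ.coord_mem_seg _ _).1 h)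

/-- The representation of `G` on smooth functions. -/
def smoothRep : Representation ℂ G Γ.Smooth where
  toFun g :=
    { toFun := fun f => ⟨act.transport g f.1, act.transport_mem g f⟩
      map_add' := fun _ _ => rfl
      map_smul' := fun _ _ => rfl }
  map_one' := by
    ext f e t
    change Γ.along f.1 (act.onEnds 1⁻¹ (e, false)) t = f.1 e t
    simp [MetricGraph.along, MetricGraph.coord]
  map_mul' g h := by
    ext f e t
    change Γ.along f.1 (act.onEnds (g * h)⁻¹ (e, false)) t =
      Γ.along (act.transport h f.1) (act.onEnds g⁻¹ (e, false)) t
    rw [along_transport, mul_inv_rev, map_mul, Equiv.Perm.mul_apply]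

theorem coe_smoothRep (g : G) (f : Γ.Smooth) :
    (act.smoothRep g f : Γ.E → ℝ → ℂ) = act.transport g f.1 := rfl

theorem smoothRep_mem_smoothBC (g : G) {f : Γ.Smooth} (hf : f ∈ Γ.SmoothBC) :
    act.smoothRep g f ∈ Γ.SmoothBC := by
  intro x
  have hv : Γ.value (act.smoothRep g f).1 = fun d => Γ.value f.1 (act.onEnds g⁻¹ d) := by
    ext d
    simp only [MetricGraph.value, coe_smoothRep, along_transport]
  have hd : Γ.outDeriv (act.smoothRep g f).1 = fun d => Γ.outDeriv f.1 (act.onEnds g⁻¹ d) := by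
    ext d
    simp only [MetricGraph.outDeriv, coe_smoothRep, along_transport, seg_onEnds]
  rw [hv, hd, ← act.boundaryCondition_iff]
  exact hf _

theorem derivWithin_coord (d : Γ.E × Bool) (f : ℝ → ℂ) (t : ℝ) :
    derivWithin (fun s => f (Γ.coord d s)) (Γ.seg d.1) t =
      (if d.2 then -1 else 1 : ℂ) * derivWithin f (Γ.seg d.1) (Γ.coord d t) := by
  rcases d with ⟨e, _ | _⟩
  · simp [MetricGraph.coord]
  · simp [MetricGraph.coord, MetricGraph.seg, derivWithin_comp_const_sub]

theorem laplacian_smoothRep (g : G) (f : Γ.Smooth) :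
    Γ.laplacian (act.smoothRep g f) = act.smoothRep g (Γ.laplacian f) := by
  ext e t
  change (Γ.seg e).indicator (fun t => -Γ.secondDeriv (act.transport g f.1) e t) t =
    Γ.along (Γ.laplacian f).1 (act.onEnds g⁻¹ (e, false)) t
  set d := act.onEnds g⁻¹ (e, false) with hd
  have hs : Γ.seg e = Γ.seg d.1 := (act.seg_onEnds g⁻¹ (e, false)).symm
  have key : Γ.secondDeriv (act.transport g f.1) e t = Γ.secondDeriv f.1 d.1 (Γ.coord d t) := by
    unfold MetricGraph.secondDeriv
    rw [transport_apply, ← hd, hs]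
    have h1 : derivWithin (Γ.along f.1 d) (Γ.seg d.1) = fun s => (if d.2 then -1 else 1 : ℂ) *
        derivWithin (f.1 d.1) (Γ.seg d.1) (Γ.coord d s) := by
      ext s
      exact derivWithin_coord d (f.1 d.1) s
    rw [h1, derivWithin_coord d
      (fun x => (if d.2 then -1 else 1 : ℂ) * derivWithin (f.1 d.1) (Γ.seg d.1) x)]
    rw [derivWithin_const_mul_field, ← mul_assoc]
    split_ifs <;> simp
  by_cases ht : t ∈ Γ.seg e
  · have ht' : Γ.coord d t ∈ Γ.seg d.1 := (Γ.coord_mem_seg d t).2 (hs ▸ ht)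
    rw [indicator_of_mem ht, key]
    exact (indicator_of_mem ht' fun t => -Γ.secondDeriv f.1 d.1 t).symm
  · have ht' : Γ.coord d t ∉ Γ.seg d.1 := fun h => ht (hs ▸ (Γ.coord_mem_seg d t).1 h)
    rw [indicator_of_notMem ht]
    exact ((Γ.laplacian f).2 d.1 |>.2 _ ht').symm

theorem H_le_comap (g : G) : Γ.H ≤ Γ.H.comap (act.smoothRep g) := by
  refine iSup_le fun μ f hf => ?_
  have h : Γ.laplacian f = μ • f := Module.End.mem_eigenspace_iff.1 hf.2
  refine le_iSup Γ.Eig μ ⟨act.smoothRep_mem_smoothBC g hf.1, Module.End.mem_eigenspace_iff.2 ?_⟩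
  rw [laplacian_smoothRep, h, map_smul]

/-- The representation of `G` on `H(Γ)`, given by `g f = f ∘ g⁻¹`. -/
noncomputable def repH : Representation ℂ G Γ.H := act.smoothRep.subrepresentation Γ.H act.H_le_comap

/-- The Laplacian on `H(Γ)`, as an equivariant map. -/
noncomputable def laplacianHom : act.repH.IntertwiningMap act.repH :=
  Γ.laplacianH.intertwiningMap_of_isIntertwiningMap act.repH act.repH
    fun g f => Subtype.ext (act.laplacian_smoothRep g f.1)

variable {W : Type w} [AddCommGroup W] [Module ℂ W] (R : Representation ℂ G W)

/-- `Hom_{ℂG}(R, H(Γ))`. -/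
abbrev Hom : Type (max w u) := R.IntertwiningMap act.repH

/-- The operator on `Hom_{ℂG}(R, H(Γ))` which sends `f` to `r ↦ -Δ (f r)`. -/
noncomputable def homLaplacian : Module.End ℂ (act.Hom R) :=
  Representation.IntertwiningMap.llcomp R act.repH act.repH act.laplacianHom

/-- `Γ'` is a `Γ/R`-graph: there is an isomorphism of `ℂ[x]`-modules
`H(Γ') ≅ Hom_{ℂG}(R, H(Γ))`, where `x` acts through the negative Laplacians. -/
def IsQuotient (Γ' : QuantumGraph.{u}) : Prop :=
  Nonempty (Module.AEval' Γ'.laplacianH ≃ₗ[ℂ[X]] Module.AEval' (act.homLaplacian R))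

/-- No element of `G` carries a vertex to one of its neighbours (and, for the identity, there are no
loops). -/
def NoNeighbours : Prop :=
  ∀ g e, act.onV g (Γ.endpt (e, false)) ≠ Γ.endpt (e, true)

/-- `R^{G_e}`: the vectors fixed by the stabilizer of the edge `e`. -/
def edgeInvariants (e : Γ.E) : Submodule ℂ W where
  carrier := {r | ∀ g, act.onE g e = e → R g r = r}
  add_mem' := by
    intro r s hr hs g hg
    rw [map_add, hr g hg, hs g hg]
  zero_mem' := fun g _ => map_zero _
  smul_mem' := by
    intro c r hr g hg
    rw [map_smul, hr g hg]

/-- The sum of the nontrivial components of the restriction of `R` to the stabilizer of the edge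
`e`: the span of the vectors `g r - r` with `g` in the stabilizer. -/
def edgeNontrivial (e : Γ.E) : Submodule ℂ W :=
  Submodule.span ℂ {r | ∃ g s, act.onE g e = e ∧ r = R g s - s}

/-- The choices on which the construction of the quotient depends: representatives for the orbits of
vertices and of edges, for each edge `e` a group element carrying the representative of its orbit to
`e`, an ordered basis of `R`, and for each representative edge `e` an ordered basis of `R` whose
first `dim R^{G_e}` vectors lie in `R^{G_e}` (hence form a basis of it), while the others lie in
the nontrivial components for `G_e`. -/
structure Choices where
  repV : Γ.V → Γ.V
  repV_invariant : ∀ g x, repV (act.onV g x) = repV x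
  repV_orbit : ∀ x, ∃ g, act.onV g (repV x) = x
  repE : Γ.E → Γ.E
  repE_invariant : ∀ g e, repE (act.onE g e) = repE e
  carry : Γ.E → G
  carry_repE : ∀ e, act.onE (carry e) (repE e) = e
  basis : Module.Basis (Fin (Module.finrank ℂ W)) ℂ W
  edgeBasis : Γ.E → Module.Basis (Fin (Module.finrank ℂ W)) ℂ W
  edgeBasis_mem : ∀ e (j : Fin (Module.finrank ℂ W)), repE e = e →
    (j : ℕ) < Module.finrank ℂ (act.edgeInvariants R e) → edgeBasis e j ∈ act.edgeInvariants R e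
  edgeBasis_dead : ∀ e (j : Fin (Module.finrank ℂ W)), repE e = e →
    Module.finrank ℂ (act.edgeInvariants R e) ≤ (j : ℕ) → edgeBasis e j ∈ act.edgeNontrivial R e

namespace Choices

variable {act R} (C : act.Choices R)

/-- The metric graph underlying the quotient: its vertices are the chosen vertices of `Γ`, its
edges are the pairs `(e, j)` with `e` a chosen edge and `j < dim R^{G_e}`, of length `len e` and with
ends at the representatives of the ends of `e`. -/
def metricGraph : MetricGraph.{u} where
  V := {x : Γ.V // C.repV x = x}
  E := {p : Γ.E × Fin (Module.finrank ℂ W) //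
    C.repE p.1 = p.1 ∧ (p.2 : ℕ) < Module.finrank ℂ (act.edgeInvariants R p.1)}
  finite_V := by
    have := Γ.finite_V
    infer_instance
  finite_E := by
    have := Γ.finite_E
    infer_instance
  endpt d := ⟨C.repV (Γ.endpt (d.1.1.1, d.2)), by
    obtain ⟨g, hg⟩ := C.repV_orbit (Γ.endpt (d.1.1.1, d.2))
    conv_rhs => rw [← hg]
    rw [C.repV_invariant]⟩
  len p := Γ.len p.1.1
  len_pos p := Γ.len_pos p.1.1

/-- The block diagonal matrix `𝔊 = diag([g_h⁻¹]_{B^{ν_h}}^{B})ᵀ`, with one block for every edge end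
`h` at `x`; here the edge of `h` is `g_h e` with `e` the representative of index `ν_h`, and
`[g⁻¹]_{B^ν}^{B}` is the matrix of `g⁻¹` from the coordinates in `B` to those in `B^ν`. -/
noncomputable def bigG (x : Γ.V) : Matrix (Γ.EndsAt x × Fin (Module.finrank ℂ W))
    (Γ.EndsAt x × Fin (Module.finrank ℂ W)) ℂ :=
  Matrix.of fun p q => if p.1 = q.1 then
    (LinearMap.toMatrix C.basis (C.edgeBasis (C.repE p.1.1.1))
      (R (C.carry p.1.1.1)⁻¹)).transpose p.2 q.2 else 0

open Classical in
/-- The matrix `Θ`, with entry `1` where the edge of the edge end at the vertex of `Γ` lies in the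
orbit of the edge of the quotient and the basis indices agree, and `0` elsewhere. -/
noncomputable def theta (x : C.metricGraph.V) :
    Matrix (Γ.EndsAt x.1 × Fin (Module.finrank ℂ W)) (C.metricGraph.EndsAt x) ℂ :=
  Matrix.of fun p c => if C.repE p.1.1.1 = c.1.1.1.1 ∧ p.2 = c.1.1.1.2 then 1 else 0

/-- The quotient: the matrices at the vertex coming from `x` are `(A x ⊗ I) 𝔊 Θ` and
`(B x ⊗ I) 𝔊 Θ`. -/
noncomputable def graph : QuantumGraph.{u} where
  toMetricGraph := C.metricGraph
  Row x := Γ.Row x.1 × Fin (Module.finrank ℂ W)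
  finite_Row x := by
    have := Γ.finite_Row x.1
    infer_instance
  A x := (Γ.A x.1 ⊗ₖ (1 : Matrix (Fin (Module.finrank ℂ W)) (Fin (Module.finrank ℂ W)) ℂ)) *
    C.bigG x.1 * C.theta x
  B x := (Γ.B x.1 ⊗ₖ (1 : Matrix (Fin (Module.finrank ℂ W)) (Fin (Module.finrank ℂ W)) ℂ)) *
    C.bigG x.1 * C.theta x

/-- `Ψ` is the encoding map: on the edge `(e, j)` of the quotient, `Ψ f` is the restriction to `e`
of the value of `f` at the `j`-th vector of the basis attached to `e`. -/
def IsEncoding (Ψ : Module.AEval' (act.homLaplacian R) → Module.AEval' C.graph.laplacianH) : Prop :=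
  ∀ (f : act.Hom R) (p : C.metricGraph.E) (t : ℝ),
    ((Module.AEval'.of C.graph.laplacianH).symm
      (Ψ (Module.AEval'.of (act.homLaplacian R) f))).1.1 p t =
    (f (C.edgeBasis p.1.1 p.1.2)).1.1 p.1.1 t

end Choices

end Action

end QuantumGraph

/-! ### Modules over `ℂ[X]` and eigenspaces -/

/-! Suppose first that no element of `G` carries an end vertex of an edge to the other end vertex.
Then the stabilizer of an edge fixes both of its ends. An equivariant map from `R` to functions on
`Γ` is a family of linear maps `F d` on `R`, one for each edge end `d`, with `F (g d) (g r) = F d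
r`. Each `F d` is invariant under the stabilizer of its edge, so it kills the nontrivial components;
hence the family is determined by the vectors `b_j`, `j ≤ d_e`, on representative edges, and these
values are arbitrary (`eq_extend`, `extend_onEnds`, `extend_basis`). This holds for families of
functions, of boundary values and of derivatives alike.

The product `𝔊 Θ` computes the family determined by data on the quotient, evaluated on the basis of
`R` (`bigG_mul_theta_mulVec`). So the conditions on `Q` say that for every `r` the extended data
satisfy the conditions on `Γ`, and encoding is a bijection on smooth functions which respects the
Laplacian and the boundary conditions. To pass to spans of eigenfunctions (`encode_mem_H_iff`), an
equivariant map from the finite-dimensional `R` involves finitely many eigenvalues and is split by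
Lagrange polynomials in the Laplacian, which commute with `G`.

In general the barycentric subdivision is taken first. It separates old vertices from midpoints, so
it satisfies the hypothesis, and it leaves `H(Γ)` unchanged because solutions of `h'' = -μ h` with
equal Cauchy data at a midpoint coincide. Subdividing the quotient, which has no loops, makes it
simple.

For exactness, let `J (a, b) = (-b, a)`. Green's formula shows that for a self-adjoint Laplacian the
boundary space `K` meets `J K` only in zero, and properness makes `K` large enough for `K ⊕ J K` to
be everything (`LaplacianIsSelfAdjoint.isSplit`). This splitting uses no inner product on `R`; it
passes to subdivisions and to quotients, since the projection onto `K` along `J K` is equivariant.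
It forces the local spaces to have half the full dimension, which is exactness. Redundant rows can
then be removed. -/

theorem Module.AEval'.exists_equiv {M N : Type*} [AddCommMonoid M] [Module ℂ M] [AddCommMonoid N]
    [Module ℂ N] (T : Module.End ℂ M) (S : Module.End ℂ N) (φ : M ≃ₗ[ℂ] N)
    (h : ∀ m, φ (T m) = S (φ m)) :
    ∃ Ψ : Module.AEval' T ≃ₗ[ℂ[X]] Module.AEval' S,
      ∀ m, Ψ (Module.AEval'.of T m) = Module.AEval'.of S (φ m) :=
  ⟨LinearEquiv.ofAEval T (φ.trans (Module.AEval'.of S)) fun m => by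
    change Module.AEval'.of S (φ (T m)) = _
    rw [h]
    exact (Module.AEval'.X_smul_of S (φ m)).symm, fun _ => rfl⟩

/-- On an eigenvector of eigenvalue `ν` a polynomial in `T` acts as its value at `ν`, so the
Lagrange basis polynomials are the projections to the summands. The subspaces `N μ` may be smaller
than the eigenspaces because eigenfunctions must also satisfy the boundary conditions. -/
theorem Module.End.aeval_lagrange_basis_apply {M : Type*} [AddCommGroup M] [Module ℂ M]
    (T : Module.End ℂ M) (N : ℂ → Submodule ℂ M) (hN : ∀ μ, N μ ≤ T.eigenspace μ)
    (s : Finset ℂ) {x : M} (hx : x ∈ ⨆ μ ∈ s, N μ) :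
    (∀ μ ∈ s, Polynomial.aeval T (Lagrange.basis s id μ) x ∈ N μ) ∧
      ∑ μ ∈ s, Polynomial.aeval T (Lagrange.basis s id μ) x = x := by
  induction hx using Submodule.iSup_induction' with
  | zero => simp
  | add x y _ _ hx hy =>
    refine ⟨fun μ hμ => ?_, ?_⟩
    · rw [map_add]
      exact Submodule.add_mem _ (hx.1 μ hμ) (hy.1 μ hμ)
    · simp only [map_add, Finset.sum_add_distrib, hx.2, hy.2]
  | mem ν x hx =>
    by_cases hν : ν ∈ s
    · simp only [hν, iSup_pos] at hx
      have key : ∀ p : ℂ[X], Polynomial.aeval T p x = p.eval ν • x := fun p => by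
        by_cases h0 : x = 0
        · simp [h0]
        · exact Module.End.aeval_apply_of_hasEigenvector ⟨hN ν hx, h0⟩
      simp only [key]
      refine ⟨fun μ hμ => ?_, ?_⟩
      · by_cases h : μ = ν
        · subst h
          exact Submodule.smul_mem _ _ hx
        · have := Lagrange.eval_basis_of_ne (s := s) (v := id) h hν
          simp only [id] at this
          rw [this, zero_smul]
          exact Submodule.zero_mem _
      · rw [Finset.sum_eq_single_of_mem ν hν]
        · have := Lagrange.eval_basis_self (s := s) (v := id) Function.injective_id.injOn hν
          simp only [id] at this
          rw [this, one_smul]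
        · intro μ hμ h
          have := Lagrange.eval_basis_of_ne (s := s) (v := id) h hν
          simp only [id] at this
          rw [this, zero_smul]
    · simp only [hν, iSup_neg, not_false_eq_true, Submodule.mem_bot] at hx
      subst hx
      simp

theorem Submodule.exists_finset_forall_mem_iSup {M W : Type*} [AddCommGroup M] [Module ℂ M]
    [AddCommGroup W] [Module ℂ W] [FiniteDimensional ℂ W] (N : ℂ → Submodule ℂ M)
    (f : W →ₗ[ℂ] M) (hf : ∀ w, f w ∈ ⨆ μ, N μ) :
    ∃ s : Finset ℂ, ∀ w, f w ∈ ⨆ μ ∈ s, N μ := by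
  classical
  let b := Module.finBasis ℂ W
  have h : ∀ i, ∃ s : Finset ℂ, f (b i) ∈ ⨆ μ ∈ s, N μ := fun i =>
    Submodule.mem_iSup_iff_exists_finset.1 (hf (b i))
  choose s hs using h
  refine ⟨Finset.univ.biUnion s, fun w => ?_⟩
  rw [← b.sum_repr w, map_sum]
  refine Submodule.sum_mem _ fun i _ => ?_
  rw [map_smul]
  refine Submodule.smul_mem _ _ ?_
  refine (iSup₂_mono' fun μ hμ => ⟨μ, ?_, le_rfl⟩ : (⨆ μ ∈ s i, N μ) ≤ _) (hs i)
  exact Finset.mem_biUnion.2 ⟨i, Finset.mem_univ _, hμ⟩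

/-! ### The equation `h'' = -μ h` -/

theorem hasDerivAt_cos_mul (k : ℂ) (t : ℝ) :
    HasDerivAt (fun t : ℝ => Complex.cos (k * t)) (-(k * Complex.sin (k * t))) t := by
  have h : HasDerivAt (fun z : ℂ => Complex.cos (k * z)) (-Complex.sin (k * t) * (k * 1)) t :=
    (Complex.hasDerivAt_cos _).comp (t : ℂ) ((hasDerivAt_id (t : ℂ)).const_mul k)
  exact h.comp_ofReal.congr_deriv (by ring)

theorem hasDerivAt_sin_mul (k : ℂ) (t : ℝ) :
    HasDerivAt (fun t : ℝ => Complex.sin (k * t)) (k * Complex.cos (k * t)) t := by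
  have h : HasDerivAt (fun z : ℂ => Complex.sin (k * z)) (Complex.cos (k * t) * (k * 1)) t :=
    (Complex.hasDerivAt_sin _).comp (t : ℂ) ((hasDerivAt_id (t : ℂ)).const_mul k)
  exact h.comp_ofReal.congr_deriv (by ring)

/-- The fundamental system of solutions of `h'' = -μ h`. -/
theorem exists_fundamental_system (μ : ℂ) : ∃ c s : ℝ → ℂ, ContDiff ℝ ∞ c ∧ ContDiff ℝ ∞ s ∧
    (∀ t, HasDerivAt c (-(μ * s t)) t) ∧ (∀ t, HasDerivAt s (c t) t) ∧ c 0 = 1 ∧ s 0 = 0 ∧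
    ∀ t, c t * c t + μ * (s t * s t) = 1 := by
  by_cases hμ : μ = 0
  · subst hμ
    refine ⟨fun _ => 1, fun t => t, contDiff_const, Complex.ofRealCLM.contDiff, fun t => ?_,
      fun t => ?_, rfl, by simp, by simp⟩
    · simpa using hasDerivAt_const t (1 : ℂ)
    · exact Complex.ofRealCLM.hasDerivAt
  · obtain ⟨k, hk⟩ := IsAlgClosed.exists_pow_nat_eq μ (n := 2) two_pos
    have hk0 : k ≠ 0 := by
      rintro rfl
      exact hμ (by simpa using hk.symm)
    have hlin : ContDiff ℝ ∞ fun t : ℝ => k * (t : ℂ) :=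
      contDiff_const.mul Complex.ofRealCLM.contDiff
    refine ⟨fun t => Complex.cos (k * t), fun t => k⁻¹ * Complex.sin (k * t), ?_, ?_, fun t => ?_,
      fun t => ?_, by simp, by simp, fun t => ?_⟩
    · exact (Complex.contDiff_cos.restrict_scalars ℝ).comp hlin
    · exact contDiff_const.mul ((Complex.contDiff_sin.restrict_scalars ℝ).comp hlin)
    · refine (hasDerivAt_cos_mul k t).congr_deriv ?_
      simp only [← hk]
      field_simp
    · refine ((hasDerivAt_sin_mul k t).const_mul k⁻¹).congr_deriv ?_
      field_simp
    · rw [← hk, ← Complex.cos_sq_add_sin_sq (k * t)]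
      field_simp

/-- `h` solves `h'' = -μ h` on `s`, with derivative `h'`. -/
def IsSolutionOn (μ : ℂ) (s : Set ℝ) (h h' : ℝ → ℂ) : Prop :=
  ∀ t ∈ s, HasDerivWithinAt h (h' t) s t ∧ HasDerivWithinAt h' (-(μ * h t)) s t

namespace IsSolutionOn

variable {μ : ℂ} {s : Set ℝ} {h h' k k' : ℝ → ℂ}

theorem mono {s' : Set ℝ} (H : IsSolutionOn μ s h h') (hs : s' ⊆ s) : IsSolutionOn μ s' h h' :=
  fun t ht => ⟨(H t (hs ht)).1.mono hs, (H t (hs ht)).2.mono hs⟩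

theorem sub (H : IsSolutionOn μ s h h') (K : IsSolutionOn μ s k k') :
    IsSolutionOn μ s (h - k) (h' - k') := fun t ht => by
  refine ⟨(H t ht).1.sub (K t ht).1, ?_⟩
  refine ((H t ht).2.sub (K t ht).2).congr_deriv ?_
  simp only [Pi.sub_apply]
  ring

theorem comp_const_sub (H : IsSolutionOn μ s h h') (l : ℝ) (hs : ∀ t ∈ s, l - t ∈ s) :
    IsSolutionOn μ s (fun t => h (l - t)) (fun t => -h' (l - t)) := fun t ht => by
  have hl : HasDerivWithinAt (fun t => l - t) (-1 : ℝ) s t := by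
    simpa using (hasDerivWithinAt_id t s).const_sub l
  refine ⟨?_, ?_⟩
  · simpa using! (H _ (hs t ht)).1.scomp t hl hs
  · simpa using! ((H _ (hs t ht)).2.scomp t hl hs).neg

theorem linearCombination {c s : ℝ → ℂ} (hc : ∀ t, HasDerivAt c (-(μ * s t)) t)
    (hs : ∀ t, HasDerivAt s (c t) t) (α β : ℂ) (S : Set ℝ) :
    IsSolutionOn μ S (fun t => α * c t + β * s t) (fun t => α * -(μ * s t) + β * c t) :=
  fun t _ => by
    refine ⟨(((hc t).const_mul α).add ((hs t).const_mul β)).hasDerivWithinAt, ?_⟩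
    refine (((((hs t).const_mul μ).neg.const_mul α).add
      ((hc t).const_mul β)).hasDerivWithinAt).congr_deriv ?_
    ring

/-- Uniqueness for the Cauchy problem. The functions `c h - s h'` and `μ s h + c h'` are constant:
they are the coefficients of `h` in the fundamental system. Both vanish at `t₀`, and `c² + μ s² = 1`
recovers `h` from them. -/
theorem eq_zero {l : ℝ} (H : IsSolutionOn μ (Icc 0 l) h h') {t₀ : ℝ} (ht₀ : t₀ ∈ Icc 0 l)
    (h0 : h t₀ = 0) (h0' : h' t₀ = 0) : ∀ t ∈ Icc 0 l, h t = 0 := by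
  obtain ⟨c, s, -, -, hc, hs, -, -, hcs⟩ := exists_fundamental_system μ
  have constant : ∀ w : ℝ → ℂ, (∀ t ∈ Icc 0 l, HasDerivWithinAt w 0 (Icc 0 l) t) → w t₀ = 0 →
      ∀ t ∈ Icc 0 l, w t = 0 := by
    intro w hw h0 t ht
    have h := fun x (hx : x ∈ Icc 0 l) => constant_of_has_deriv_right_zero
      (fun t ht => (hw t ht).continuousWithinAt) (fun t ht =>
        ((hw t ⟨ht.1, ht.2.le⟩).mono_of_mem_nhdsWithin (Icc_mem_nhdsGE_of_mem ht))) x hx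
    rw [h t ht, ← h t₀ ht₀, h0]
  have hu := constant (fun t => c t * h t - s t * h' t) (fun t ht => by
    refine (((hc t).hasDerivWithinAt.mul (H t ht).1).sub
      ((hs t).hasDerivWithinAt.mul (H t ht).2)).congr_deriv ?_
    ring) (by simp [h0, h0'])
  have hv := constant (fun t => μ * (s t * h t) + c t * h' t) (fun t ht => by
    refine ((((hs t).hasDerivWithinAt.mul (H t ht).1).const_mul μ).add
      ((hc t).hasDerivWithinAt.mul (H t ht).2)).congr_deriv ?_
    ring) (by simp [h0, h0'])
  intro t ht
  have h1 : c t * h t - s t * h' t = 0 := hu t ht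
  have h2 : μ * (s t * h t) + c t * h' t = 0 := hv t ht
  linear_combination c t * h1 + s t * h2 - h t * hcs t

theorem eqOn {l : ℝ} (H : IsSolutionOn μ (Icc 0 l) h h') (K : IsSolutionOn μ (Icc 0 l) k k')
    {t₀ : ℝ} (ht₀ : t₀ ∈ Icc 0 l) (h0 : h t₀ = k t₀) (h0' : h' t₀ = k' t₀) :
    ∀ t ∈ Icc 0 l, h t = k t := fun t ht =>
  sub_eq_zero.1 ((H.sub K).eq_zero ht₀ (sub_eq_zero.2 h0) (sub_eq_zero.2 h0') t ht)

end IsSolutionOn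

namespace QuantumGraph.Action

variable {G : Type v} [Group G] {Γ : QuantumGraph.{u}} (act : Γ.Action G)

/-! ### The action on edges -/

theorem fst_onEnds (g : G) (d : Γ.E × Bool) : (act.onEnds g d).1 = act.onE g d.1 := by
  rcases d with ⟨e, _ | _⟩
  · rfl
  · have h : act.onEnds g (e, true) = MetricGraph.flip (act.onEnds g (e, false)) :=
      act.onEnds_flip g (e, false)
    rw [h]
    rfl

theorem onEnds_mul (g h : G) (d : Γ.E × Bool) :
    act.onEnds (g * h) d = act.onEnds g (act.onEnds h d) := by
  rw [map_mul, Equiv.Perm.mul_apply]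

theorem onEnds_one (d : Γ.E × Bool) : act.onEnds 1 d = d := by
  rw [map_one, Equiv.Perm.one_apply]

theorem onEnds_inv_onEnds (g : G) (d : Γ.E × Bool) : act.onEnds g⁻¹ (act.onEnds g d) = d := by
  rw [← onEnds_mul, inv_mul_cancel, onEnds_one]

theorem onEnds_onEnds_inv (g : G) (d : Γ.E × Bool) : act.onEnds g (act.onEnds g⁻¹ d) = d := by
  rw [← onEnds_mul, mul_inv_cancel, onEnds_one]

theorem onE_one (e : Γ.E) : act.onE 1 e = e := by
  rw [onE, onEnds_one]

theorem onE_mul (g h : G) (e : Γ.E) : act.onE (g * h) e = act.onE g (act.onE h e) := by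
  rw [onE, onEnds_mul, fst_onEnds]
  rfl

theorem onE_inv_of_eq {g : G} {e e' : Γ.E} (h : act.onE g e = e') : act.onE g⁻¹ e' = e := by
  rw [← h, ← onE_mul, inv_mul_cancel, onE_one]

/-- The stabilizer of an edge. -/
def edgeStabilizer (e : Γ.E) : Subgroup G where
  carrier := {g | act.onE g e = e}
  mul_mem' {g h} hg hh := by
    have hg : act.onE g e = e := hg
    have hh : act.onE h e = e := hh
    change act.onE (g * h) e = e
    rw [onE_mul, hh, hg]
  one_mem' := act.onE_one e
  inv_mem' hg := act.onE_inv_of_eq hg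

-- An element that fixes an edge but swaps its ends would carry one end vertex to the other. This is
-- where the hypothesis makes stabilizers of edges act trivially along the edge.
variable {act} in
theorem NoNeighbours.onEnds_eq (hN : act.NoNeighbours) {g : G} {d : Γ.E × Bool}
    (h : act.onE g d.1 = d.1) : act.onEnds g d = d := by
  have key : ∀ e, act.onE g e = e → act.onEnds g (e, false) = (e, false) := by
    intro e he
    have h1 : (act.onEnds g (e, false)).1 = e := he
    by_contra hne
    have h2 : act.onEnds g (e, false) = (e, true) := by
      refine Prod.ext h1 ?_
      by_contra h3
      exact hne (Prod.ext h1 (by simpa using h3))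
    apply hN g e
    rw [← act.endpt_onEnds, h2]
  rcases d with ⟨e, _ | _⟩
  · exact key e h
  · have h' : act.onEnds g (e, true) = MetricGraph.flip (act.onEnds g (e, false)) :=
      act.onEnds_flip g (e, false)
    rw [h', key e h]
    rfl

variable {act} in
theorem NoNeighbours.onV_ne (hN : act.NoNeighbours) (g : G) (d : Γ.E × Bool) :
    act.onV g (Γ.endpt d) ≠ Γ.endpt (MetricGraph.flip d) := by
  rcases d with ⟨e, _ | _⟩
  · exact hN g e
  · intro h
    apply hN g⁻¹ e
    have h' : Γ.endpt (e, false) = act.onV g (Γ.endpt (e, true)) := h.symm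
    rw [h', ← Equiv.Perm.mul_apply, ← map_mul, inv_mul_cancel, map_one, Equiv.Perm.one_apply]

/-! ### Averaging over the stabilizer of an edge -/

section Average

variable [Finite G] {W : Type w} [AddCommGroup W] [Module ℂ W] (R : Representation ℂ G W)

open Classical in
/-- The sum of the operators of the stabilizer of an edge. -/
noncomputable def edgeSum (e : Γ.E) : W →ₗ[ℂ] W :=
  letI := Fintype.ofFinite (act.edgeStabilizer e)
  ∑ g : act.edgeStabilizer e, R g

theorem edgeSum_of_mem_edgeInvariants {e : Γ.E} {r : W} (hr : r ∈ act.edgeInvariants R e) :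
    act.edgeSum R e r = (Nat.card (act.edgeStabilizer e) : ℂ) • r := by
  classical
  let := Fintype.ofFinite (act.edgeStabilizer e)
  rw [edgeSum, LinearMap.sum_apply, Finset.sum_congr rfl fun g _ => hr g.1 g.2, Finset.sum_const,
    Finset.card_univ, Nat.card_eq_fintype_card, Nat.cast_smul_eq_nsmul]

theorem edgeSum_of_mem_edgeNontrivial {e : Γ.E} {r : W} (hr : r ∈ act.edgeNontrivial R e) :
    act.edgeSum R e r = 0 := by
  classical
  let := Fintype.ofFinite (act.edgeStabilizer e)
  have h : act.edgeNontrivial R e ≤ LinearMap.ker (act.edgeSum R e) := by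
    refine Submodule.span_le.2 ?_
    rintro _ ⟨g, s, hg, rfl⟩
    change act.edgeSum R e (R g s - s) = 0
    rw [map_sub, sub_eq_zero, edgeSum, LinearMap.sum_apply, LinearMap.sum_apply]
    refine Fintype.sum_equiv (Equiv.mulRight (⟨g, hg⟩ : act.edgeStabilizer e)) _ _ fun x => ?_
    simp
  exact h hr

theorem edgeSum_mem_edgeInvariants (e : Γ.E) (r : W) :
    act.edgeSum R e r ∈ act.edgeInvariants R e := by
  classical
  let := Fintype.ofFinite (act.edgeStabilizer e)
  intro g hg
  rw [edgeSum, LinearMap.sum_apply, map_sum]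
  refine Fintype.sum_equiv (Equiv.mulLeft (⟨g, hg⟩ : act.edgeStabilizer e)) _ _ fun x => ?_
  simp

theorem card_smul_sub_edgeSum_mem (e : Γ.E) (r : W) :
    (Nat.card (act.edgeStabilizer e) : ℂ) • r - act.edgeSum R e r ∈ act.edgeNontrivial R e := by
  classical
  let := Fintype.ofFinite (act.edgeStabilizer e)
  have h : (Nat.card (act.edgeStabilizer e) : ℂ) • r - act.edgeSum R e r =
      -∑ g : act.edgeStabilizer e, (R g r - r) := by
    rw [edgeSum, LinearMap.sum_apply, Finset.sum_sub_distrib, Finset.sum_const,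
      Finset.card_univ, Nat.card_eq_fintype_card, Nat.cast_smul_eq_nsmul, neg_sub]
  rw [h]
  exact Submodule.neg_mem _ (Submodule.sum_mem _ fun g _ =>
    Submodule.subset_span ⟨g.1, r, g.2, rfl⟩)

theorem card_edgeStabilizer_ne_zero (e : Γ.E) : (Nat.card (act.edgeStabilizer e) : ℂ) ≠ 0 :=
  Nat.cast_ne_zero.2 Nat.card_pos.ne'

/-- The sum over the stabilizer, divided by its order, is the projection onto the invariants along
the nontrivial components. -/
theorem isCompl_edgeInvariants_edgeNontrivial (e : Γ.E) :
    IsCompl (act.edgeInvariants R e) (act.edgeNontrivial R e) := by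
  have hc := act.card_edgeStabilizer_ne_zero e
  rw [isCompl_iff, Submodule.disjoint_def, Submodule.codisjoint_iff_exists_add_eq]
  refine ⟨fun r h1 h2 => ?_, fun r => ?_⟩
  · have h := act.edgeSum_of_mem_edgeInvariants R h1
    rw [act.edgeSum_of_mem_edgeNontrivial R h2] at h
    exact (smul_eq_zero.1 h.symm).resolve_left hc
  · refine ⟨(Nat.card (act.edgeStabilizer e) : ℂ)⁻¹ • act.edgeSum R e r,
      (Nat.card (act.edgeStabilizer e) : ℂ)⁻¹ • ((Nat.card (act.edgeStabilizer e) : ℂ) • r -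
        act.edgeSum R e r), Submodule.smul_mem _ _ (act.edgeSum_mem_edgeInvariants R e r),
      Submodule.smul_mem _ _ (act.card_smul_sub_edgeSum_mem R e r), ?_⟩
    rw [← smul_add, add_sub_cancel, smul_smul, inv_mul_cancel₀ hc, one_smul]

theorem exists_edgeBasis [FiniteDimensional ℂ W] (e : Γ.E) :
    ∃ b : Module.Basis (Fin (Module.finrank ℂ W)) ℂ W, ∀ j : Fin (Module.finrank ℂ W),
      ((j : ℕ) < Module.finrank ℂ (act.edgeInvariants R e) → b j ∈ act.edgeInvariants R e) ∧
      (Module.finrank ℂ (act.edgeInvariants R e) ≤ (j : ℕ) → b j ∈ act.edgeNontrivial R e) := by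
  have hI := act.isCompl_edgeInvariants_edgeNontrivial R e
  have hn := Submodule.finrank_add_eq_of_isCompl hI
  let b₀ := ((Module.finBasis ℂ (act.edgeInvariants R e)).prod
    (Module.finBasis ℂ (act.edgeNontrivial R e))).map (Submodule.prodEquivOfIsCompl _ _ hI)
  refine ⟨b₀.reindex (finSumFinEquiv.trans (finCongr hn)), fun j => ?_⟩
  obtain ⟨i, rfl⟩ := (finSumFinEquiv.trans (finCongr hn)).surjective j
  rw [Module.Basis.reindex_apply, Equiv.symm_apply_apply]
  rcases i with i | i
  · refine ⟨fun _ => ?_, fun h => absurd h (by simp)⟩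
    simp [b₀]
  · refine ⟨fun h => absurd h (by simp), fun _ => ?_⟩
    simp [b₀]

theorem nonempty_choices [FiniteDimensional ℂ W] : Nonempty (act.Choices R) := by
  let rV : Setoid Γ.V := ⟨fun x y => ∃ g, act.onV g x = y,
    fun x => ⟨1, by simp⟩, fun {x y} ⟨g, h⟩ => ⟨g⁻¹, by simp [← h]⟩,
    fun {x y z} ⟨g, h⟩ ⟨k, h'⟩ => ⟨k * g, by simp [← h', ← h]⟩⟩
  let rE : Setoid Γ.E := ⟨fun x y => ∃ g, act.onE g x = y,
    fun x => ⟨1, act.onE_one x⟩, fun {x y} ⟨g, h⟩ => ⟨g⁻¹, act.onE_inv_of_eq h⟩,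
    fun {x y z} ⟨g, h⟩ ⟨k, h'⟩ => ⟨k * g, by rw [onE_mul, h, h']⟩⟩
  have hE : ∀ e : Γ.E, ∃ g, act.onE g (Quotient.out (Quotient.mk rE e)) = e := fun e =>
    Quotient.mk_out (s := rE) e
  choose carry hcarry using hE
  choose b hb using act.exists_edgeBasis R
  exact ⟨{
    repV := fun x => Quotient.out (Quotient.mk rV x)
    repV_invariant := fun g x => congrArg Quotient.out
      (Quotient.sound (s := rV) ⟨g⁻¹, by simp⟩)
    repV_orbit := fun x => Quotient.mk_out (s := rV) x
    repE := fun e => Quotient.out (Quotient.mk rE e)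
    repE_invariant := fun g e => congrArg Quotient.out
      (Quotient.sound (s := rE) ⟨g⁻¹, act.onE_inv_of_eq rfl⟩)
    carry := carry
    carry_repE := hcarry
    basis := Module.finBasis ℂ W
    edgeBasis := b
    edgeBasis_mem := fun e j _ h => (hb e j).1 h
    edgeBasis_dead := fun e j _ h => (hb e j).2 h }⟩

end Average

namespace Choices

variable {act} {W : Type w} [AddCommGroup W] [Module ℂ W] {R : Representation ℂ G W}
  (C : act.Choices R)

theorem repE_repE (e : Γ.E) : C.repE (C.repE e) = C.repE e := by
  conv_rhs => rw [← C.carry_repE e]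
  rw [C.repE_invariant]

variable [Finite G]

/-! ### Coordinates of invariant vectors -/

/-- Summing over the stabilizer kills `r`. Applied to the expansion of `r` it multiplies the first
basis vectors by the order of the stabilizer and kills the others, so linear independence makes the
first coordinates vanish. -/
theorem coord_edgeNontrivial {e : Γ.E} (he : C.repE e = e) {j : Fin (Module.finrank ℂ W)}
    (hj : (j : ℕ) < Module.finrank ℂ (act.edgeInvariants R e)) {r : W}
    (hr : r ∈ act.edgeNontrivial R e) : (C.edgeBasis e).coord j r = 0 := by
  classical
  have h := act.edgeSum_of_mem_edgeNontrivial R hr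
  have h' : act.edgeSum R e r = (Nat.card (act.edgeStabilizer e) : ℂ) •
      ∑ i : Fin (Module.finrank ℂ W), (if (i : ℕ) < Module.finrank ℂ (act.edgeInvariants R e) then
        (C.edgeBasis e).repr r i else 0) • C.edgeBasis e i := by
    conv_lhs => rw [← (C.edgeBasis e).sum_repr r, map_sum]
    rw [Finset.smul_sum]
    refine Finset.sum_congr rfl fun i _ => ?_
    split_ifs with hi
    · rw [map_smul, act.edgeSum_of_mem_edgeInvariants R (C.edgeBasis_mem e i he hi), smul_comm]
    · rw [map_smul, act.edgeSum_of_mem_edgeNontrivial R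
        (C.edgeBasis_dead e i he (not_lt.1 hi)), smul_zero, zero_smul, smul_zero]
  rw [h'] at h
  have h2 := (smul_eq_zero.1 h).resolve_left (act.card_edgeStabilizer_ne_zero e)
  have h3 := Fintype.linearIndependent_iff.1 (C.edgeBasis e).linearIndependent _ h2 j
  rwa [if_pos hj] at h3

theorem coord_stabilizer {e : Γ.E} (he : C.repE e = e) {j : Fin (Module.finrank ℂ W)}
    (hj : (j : ℕ) < Module.finrank ℂ (act.edgeInvariants R e)) {s : G} (hs : act.onE s e = e)
    (r : W) : (C.edgeBasis e).coord j (R s r) = (C.edgeBasis e).coord j r := by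
  rw [← sub_eq_zero, ← map_sub]
  exact C.coord_edgeNontrivial he hj (Submodule.subset_span ⟨s, r, hs, rfl⟩)

end Choices

end QuantumGraph.Action

namespace QuantumGraph.Action.Choices

variable {G : Type v} [Group G] {Γ : QuantumGraph.{u}} {act : Γ.Action G}
  {W : Type w} [AddCommGroup W] [Module ℂ W] {R : Representation ℂ G W} (C : act.Choices R)
  {M : Type*} [AddCommGroup M] [Module ℂ M]

/-! ### Equivariant families of functionals and functions on the quotient -/

theorem fst_onEnds_carry_inv (d : Γ.E × Bool) :
    (act.onEnds (C.carry d.1)⁻¹ d).1 = C.repE d.1 := by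
  rw [act.fst_onEnds]
  exact act.onE_inv_of_eq (C.carry_repE d.1)

open Classical in
/-- The equivariant family of linear maps on `W`, indexed by the edge ends of `Γ`, which is
determined by a function on the edge ends of the quotient. -/
noncomputable def extend (u : C.metricGraph.E × Bool → M) (d : Γ.E × Bool) : W →ₗ[ℂ] M :=
  ∑ p : C.metricGraph.E, if p.1.1 = C.repE d.1 then
    (((C.edgeBasis p.1.1).coord p.1.2).comp (R (C.carry d.1)⁻¹)).smulRight
      -- The Boolean selects the end of the representative edge which `carry` takes to `d`.
      (u (p, (act.onEnds (C.carry d.1)⁻¹ d).2)) else 0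

open Classical in
theorem extend_apply (u : C.metricGraph.E × Bool → M) (d : Γ.E × Bool) (r : W) :
    C.extend u d r = ∑ p : C.metricGraph.E, if p.1.1 = C.repE d.1 then
      (C.edgeBasis p.1.1).coord p.1.2 (R (C.carry d.1)⁻¹ r) •
        u (p, (act.onEnds (C.carry d.1)⁻¹ d).2) else 0 := by
  rw [extend, LinearMap.sum_apply]
  refine Finset.sum_congr rfl fun p _ => ?_
  split_ifs <;> rfl

theorem extend_zero (d : Γ.E × Bool) : C.extend (0 : C.metricGraph.E × Bool → M) d = 0 := by
  ext r
  rw [extend_apply]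
  simp

theorem extend_add (u v : C.metricGraph.E × Bool → M) (d : Γ.E × Bool) :
    C.extend (u + v) d = C.extend u d + C.extend v d := by
  ext r
  rw [LinearMap.add_apply, extend_apply, extend_apply, extend_apply, ← Finset.sum_add_distrib]
  refine Finset.sum_congr rfl fun p _ => ?_
  split_ifs <;> simp

theorem extend_neg (u : C.metricGraph.E × Bool → M) (d : Γ.E × Bool) :
    C.extend (-u) d = -C.extend u d := by
  have h := C.extend_add u (-u) d
  rw [add_neg_cancel, extend_zero] at h
  exact eq_neg_of_add_eq_zero_right h.symm

theorem map_extend {N : Type*} [AddCommGroup N] [Module ℂ N] (L : M →ₗ[ℂ] N)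
    (u : C.metricGraph.E × Bool → M) (d : Γ.E × Bool) (r : W) :
    L (C.extend u d r) = C.extend (fun c => L (u c)) d r := by
  rw [extend_apply, extend_apply, map_sum]
  refine Finset.sum_congr rfl fun p _ => ?_
  split_ifs <;> simp

theorem carry_stabilizer (g : G) (e : Γ.E) :
    act.onE ((C.carry (act.onE g e))⁻¹ * g * C.carry e) (C.repE e) = C.repE e := by
  rw [act.onE_mul, act.onE_mul, C.carry_repE]
  refine (act.onE_inv_of_eq (C.carry_repE _)).trans ?_
  rw [C.repE_invariant]

/-- Equivariant families are determined by their values on the basis vectors. -/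
theorem eq_of_equivariant (hN : act.NoNeighbours) {F F' : Γ.E × Bool → W →ₗ[ℂ] M}
    (hF : ∀ g d r, F (act.onEnds g d) (R g r) = F d r)
    (hF' : ∀ g d r, F' (act.onEnds g d) (R g r) = F' d r)
    (h : ∀ c : C.metricGraph.E × Bool, F (c.1.1.1, c.2) (C.edgeBasis c.1.1.1 c.1.1.2) =
      F' (c.1.1.1, c.2) (C.edgeBasis c.1.1.1 c.1.1.2)) : F = F' := by
  -- An element stabilizing the edge fixes the end `d`, so `F d` is invariant under it and vanishes
  -- on the vectors `g s - s`.
  have dead : ∀ F : Γ.E × Bool → W →ₗ[ℂ] M, (∀ g d r, F (act.onEnds g d) (R g r) = F d r) →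
      ∀ d r, r ∈ act.edgeNontrivial R d.1 → F d r = 0 := by
    intro F hF d r hr
    have hle : act.edgeNontrivial R d.1 ≤ LinearMap.ker (F d) := by
      refine Submodule.span_le.2 ?_
      rintro _ ⟨g, s, hg, rfl⟩
      change F d (R g s - s) = 0
      rw [map_sub, sub_eq_zero, ← hF g d s, hN.onEnds_eq hg]
    exact hle hr
  have rep : ∀ d, C.repE d.1 = d.1 → F d = F' d := by
    rintro ⟨e, b⟩ he
    refine (C.edgeBasis e).ext fun j => ?_
    by_cases hj : (j : ℕ) < Module.finrank ℂ (act.edgeInvariants R e)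
    · exact h (⟨(e, j), he, hj⟩, b)
    · have hd := C.edgeBasis_dead e j he (not_lt.1 hj)
      rw [dead F hF (e, b) _ hd, dead F' hF' (e, b) _ hd]
  funext d
  ext r
  rw [← hF (C.carry d.1)⁻¹, ← hF' (C.carry d.1)⁻¹, rep]
  rw [C.fst_onEnds_carry_inv, C.repE_repE]

/-- The block of `𝔊` at `h`, in row `i`, contains the `B^ẽ`-coordinates of `g_e⁻¹` applied to the
`i`-th basis vector, and `Θ` keeps those belonging to edges of the quotient. These are the
coefficients in `extend`. -/
theorem bigG_mul_theta_mulVec (hN : act.NoNeighbours) (x : C.metricGraph.V)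
    (a : C.metricGraph.E × Bool → ℂ) (h : Γ.EndsAt x.1) (i : Fin (Module.finrank ℂ W)) :
    Matrix.mulVec (C.bigG x.1 * C.theta x) (fun c => a c.1) (h, i) =
      C.extend a h.1 (C.basis i) := by
  classical
  have h1 : ∀ c : C.metricGraph.EndsAt x, (C.bigG x.1 * C.theta x) (h, i) c =
      if c.1.1.1.1 = C.repE h.1.1 then
        (C.edgeBasis c.1.1.1.1).coord c.1.1.1.2 (R (C.carry h.1.1)⁻¹ (C.basis i)) else 0 := by
    intro c
    rw [Matrix.mul_apply, Finset.sum_eq_single (h, c.1.1.1.2)]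
    · by_cases hc : c.1.1.1.1 = C.repE h.1.1
      · simp [bigG, theta, hc, LinearMap.toMatrix_apply]
      · simp [theta, hc, Ne.symm hc]
    · rintro ⟨h', k⟩ _ hne
      by_cases hh : h = h'
      · subst hh
        have : k ≠ c.1.1.1.2 := fun hk => hne (by rw [hk])
        simp [theta, this]
      · simp [bigG, hh]
    · exact fun h => absurd (Finset.mem_univ _) h
  -- `Θ` does not record which end of an edge is meant. It need not: if the opposite end also lay at
  -- `x`, a group element would carry an end vertex of the edge of `h` to the other one. So each
  -- edge of the quotient over this orbit has exactly one end at `x`.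
  have hbit : ∀ c : C.metricGraph.EndsAt x, c.1.1.1.1 = C.repE h.1.1 →
      c.1.2 = (act.onEnds (C.carry h.1.1)⁻¹ h.1).2 := by
    intro c hc
    by_contra hne
    have hflip : ((c.1.1.1.1, c.1.2) : Γ.E × Bool) =
        MetricGraph.flip (act.onEnds (C.carry h.1.1)⁻¹ h.1) := by
      refine Prod.ext (hc.trans (C.fst_onEnds_carry_inv h.1).symm) ?_
      simpa [MetricGraph.flip] using Bool.eq_not.2 hne
    have h2 : C.repV (Γ.endpt (c.1.1.1.1, c.1.2)) = x.1 := congrArg Subtype.val c.2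
    obtain ⟨g, hg⟩ := C.repV_orbit (Γ.endpt (c.1.1.1.1, c.1.2))
    refine hN.onV_ne (g * C.carry h.1.1) (act.onEnds (C.carry h.1.1)⁻¹ h.1) ?_
    rw [← hflip, ← hg, h2, ← act.endpt_onEnds, act.onEnds_mul, act.onEnds_onEnds_inv,
      act.endpt_onEnds]
    exact congrArg (act.onV g) h.2
  rw [extend_apply, Matrix.mulVec, dotProduct]
  simp only [h1, ite_mul, zero_mul, smul_eq_mul]
  rw [← Finset.sum_filter, ← Finset.sum_filter]
  refine Finset.sum_of_injOn (fun c => c.1.1) ?_ ?_ ?_ ?_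
  · intro c hc c' hc' hcc
    have hc := (Finset.mem_filter.1 (Finset.mem_coe.1 hc)).2
    have hc' := (Finset.mem_filter.1 (Finset.mem_coe.1 hc')).2
    exact Subtype.ext (Prod.ext hcc ((hbit c hc).trans (hbit c' hc').symm))
  · intro c hc
    have hc := (Finset.mem_filter.1 (Finset.mem_coe.1 hc)).2
    exact Finset.mem_coe.2 (Finset.mem_filter.2 ⟨Finset.mem_univ _, hc⟩)
  · intro p hp hp'
    have hp := (Finset.mem_filter.1 hp).2
    refine absurd ⟨⟨(p, (act.onEnds (C.carry h.1.1)⁻¹ h.1).2), Subtype.ext ?_⟩, ?_, rfl⟩ hp'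
    · change C.repV (Γ.endpt (p.1.1, (act.onEnds (C.carry h.1.1)⁻¹ h.1).2)) = x.1
      have h3 : ((p.1.1, (act.onEnds (C.carry h.1.1)⁻¹ h.1).2) : Γ.E × Bool) =
          act.onEnds (C.carry h.1.1)⁻¹ h.1 :=
        Prod.ext (hp.trans (C.fst_onEnds_carry_inv h.1).symm) rfl
      rw [h3, act.endpt_onEnds, C.repV_invariant, h.2, x.2]
    · exact Finset.mem_coe.2 (Finset.mem_filter.2 ⟨Finset.mem_univ _, hp⟩)
  · intro c hc
    have hc := (Finset.mem_filter.1 hc).2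
    rw [← hbit c hc]

theorem _root_.QuantumGraph.boundaryCondition_iff_sum (x : Γ.V) (a b : Γ.E × Bool → ℂ) :
    Γ.BoundaryCondition x a b ↔ ∀ k, ∑ h, Γ.A x k h * a h.1 + ∑ h, Γ.B x k h * b h.1 = 0 :=
  funext_iff

theorem _root_.QuantumGraph.boundaryCondition_basis_iff {ι : Type*} (e : Module.Basis ι ℂ W)
    (x : Γ.V) (P Q : Γ.E × Bool → W →ₗ[ℂ] ℂ) :
    (∀ r, Γ.BoundaryCondition x (fun d => P d r) (fun d => Q d r)) ↔
      ∀ i, Γ.BoundaryCondition x (fun d => P d (e i)) (fun d => Q d (e i)) := by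
  refine ⟨fun h i => h (e i), fun h r => ?_⟩
  simp only [boundaryCondition_iff_sum] at h ⊢
  intro k
  have hL : ∑ h, Γ.A x k h • P h.1 + ∑ h, Γ.B x k h • Q h.1 = 0 :=
    e.ext fun i => by simpa using h i k
  simpa using LinearMap.congr_fun hL r

/-- The row `(k, i)` of the condition on the quotient is the row `k` of the condition on `Γ` for the
data extended and evaluated at the `i`-th basis vector. By linearity in `r`, basis vectors suffice.
-/
theorem boundaryCondition_graph_iff (hN : act.NoNeighbours) (x : C.metricGraph.V)
    (a b : C.metricGraph.E × Bool → ℂ) :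
    C.graph.BoundaryCondition x a b ↔
      ∀ r, Γ.BoundaryCondition x.1 (fun d => C.extend a d r) (fun d => C.extend b d r) := by
  have key : ∀ (X : Matrix (Γ.Row x.1) (Γ.EndsAt x.1) ℂ) (u : C.metricGraph.E × Bool → ℂ) k i,
      Matrix.mulVec ((X.kronecker (1 : Matrix (Fin (Module.finrank ℂ W))
        (Fin (Module.finrank ℂ W)) ℂ)) * C.bigG x.1 * C.theta x) (fun c => u c.1) (k, i) =
      ∑ h, X k h * C.extend u h.1 (C.basis i) := by
    intro X u k i
    rw [Matrix.mul_assoc, ← Matrix.mulVec_mulVec, Matrix.mulVec, dotProduct, Fintype.sum_prod_type]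
    refine Finset.sum_congr rfl fun h _ => ?_
    simp only [C.bigG_mul_theta_mulVec hN, Matrix.kronecker, Matrix.kroneckerMap_apply,
      Matrix.one_apply, mul_ite, mul_one, mul_zero, ite_mul, zero_mul, Finset.sum_ite_eq,
      Finset.mem_univ, if_true]
  rw [Γ.boundaryCondition_basis_iff C.basis]
  simp only [Γ.boundaryCondition_iff_sum, ← key]
  refine ⟨fun h i k => congrFun h (k, i), fun h => funext fun ki => h ki.2 ki.1⟩

variable [Finite G]

/-- The elements `carry (g e)` and `g * carry e` differ by an element of the stabilizer of the
representative edge. It fixes the ends of that edge and does not affect the first coordinates. -/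
theorem extend_onEnds (hN : act.NoNeighbours) (u : C.metricGraph.E × Bool → M) (g : G)
    (d : Γ.E × Bool) (r : W) : C.extend u (act.onEnds g d) (R g r) = C.extend u d r := by
  have hs := C.carry_stabilizer g d.1
  have hd : act.onEnds (C.carry (act.onE g d.1))⁻¹ (act.onEnds g d) =
      act.onEnds (C.carry d.1)⁻¹ d := by
    rw [← C.fst_onEnds_carry_inv d] at hs
    have h := hN.onEnds_eq hs
    rwa [act.onEnds_mul, act.onEnds_mul, act.onEnds_onEnds_inv] at h
  rw [extend_apply, extend_apply, act.fst_onEnds, C.repE_invariant, hd]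
  refine Finset.sum_congr rfl fun p _ => ?_
  split_ifs with hp
  · rw [← hp] at hs
    have h := C.coord_stabilizer p.2.1 p.2.2 hs (R (C.carry d.1)⁻¹ r)
    rw [map_mul, map_mul, Module.End.mul_apply, Module.End.mul_apply, ← Module.End.mul_apply (R _)
      (R (C.carry d.1)⁻¹), ← map_mul R _ (C.carry d.1)⁻¹, mul_inv_cancel, map_one,
      Module.End.one_apply] at h
    rw [h]
  · rfl

theorem extend_basis (hN : act.NoNeighbours) (u : C.metricGraph.E × Bool → M)
    (c : C.metricGraph.E × Bool) :
    C.extend u (c.1.1.1, c.2) (C.edgeBasis c.1.1.1 c.1.1.2) = u c := by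
  have he : C.repE c.1.1.1 = c.1.1.1 := c.1.2.1
  -- The element chosen for a representative edge need not be `1`, but it stabilizes the edge, and
  -- this suffices.
  have hs : act.onE (C.carry c.1.1.1)⁻¹ c.1.1.1 = c.1.1.1 := by
    refine act.onE_inv_of_eq ?_
    conv_lhs => rw [← he]
    rw [he]
    conv_rhs => rw [← C.carry_repE c.1.1.1]
    rw [he]
  rw [extend_apply]
  rw [hN.onEnds_eq (d := (c.1.1.1, c.2)) hs, Finset.sum_eq_single c.1]
  · rw [if_pos he.symm, C.coord_stabilizer he c.1.2.2 hs]
    simp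
  · intro p _ hp
    split_ifs with h
    · have h' : p.1.1 = c.1.1.1 := h.trans he
      rw [h', C.coord_stabilizer he (h' ▸ p.2.2) hs]
      have hne : c.1.1.2 ≠ p.1.2 := fun h2 => hp (Subtype.ext (Prod.ext h' h2.symm))
      simp [hne]
    · rfl
  · exact fun h => absurd (Finset.mem_univ _) h

theorem eq_extend (hN : act.NoNeighbours) {F : Γ.E × Bool → W →ₗ[ℂ] M}
    (hF : ∀ g d r, F (act.onEnds g d) (R g r) = F d r) :
    F = C.extend fun c => F (c.1.1.1, c.2) (C.edgeBasis c.1.1.1 c.1.1.2) :=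
  C.eq_of_equivariant hN hF (C.extend_onEnds hN _) fun c => (C.extend_basis hN
    (fun c => F (c.1.1.1, c.2) (C.edgeBasis c.1.1.1 c.1.1.2)) c).symm

/-- The quotient imposes conditions only at representative vertices. Equivariance moves them along
the orbits, with `r` replaced by `g⁻¹ r`, which is harmless as `r` is arbitrary. -/
theorem forall_boundaryCondition_graph_iff (hN : act.NoNeighbours)
    (a b : C.metricGraph.E × Bool → ℂ) :
    (∀ x, C.graph.BoundaryCondition x a b) ↔
      ∀ r y, Γ.BoundaryCondition y (fun d => C.extend a d r) (fun d => C.extend b d r) := by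
  refine ⟨fun h r y => ?_, fun h x => (C.boundaryCondition_graph_iff hN x a b).2 fun r => h r _⟩
  obtain ⟨g, hg⟩ := C.repV_orbit y
  have hx : C.repV (C.repV y) = C.repV y := by
    conv_rhs => rw [← hg]
    rw [C.repV_invariant]
  have h1 := (C.boundaryCondition_graph_iff hN ⟨C.repV y, hx⟩ a b).1 (h _) (R g⁻¹ r)
  rw [← hg, act.boundaryCondition_iff]
  have h2 : ∀ u : C.metricGraph.E × Bool → ℂ,
      (fun d => C.extend u (act.onEnds g d) r) = fun d => C.extend u d (R g⁻¹ r) := by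
    intro u
    funext d
    rw [← C.extend_onEnds hN u g d, ← Module.End.mul_apply, ← map_mul, mul_inv_cancel, map_one,
      Module.End.one_apply]
  rw [h2, h2]
  exact h1

end QuantumGraph.Action.Choices

/-! ### Subspaces of `M × M` complementary to their rotation -/

/-- The rotation is `J (a, b) = (-b, a)`, so `(a, b)` lies in `J K` exactly when `(b, -a)` lies in
`K`. -/
theorem Submodule.isCompl_map_skewSwap_iff {M : Type*} [AddCommGroup M] [Module ℂ M]
    (K : Submodule ℂ (M × M)) :
    IsCompl K (K.map (LinearEquiv.skewSwap ℂ M M).toLinearMap) ↔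
      (∀ a b, (a, b) ∈ K → (b, -a) ∈ K → a = 0 ∧ b = 0) ∧
      ∀ a b, ∃ p q p' q', (p, q) ∈ K ∧ (p', q') ∈ K ∧ a = p - q' ∧ b = q + p' := by
  rw [isCompl_iff, Submodule.disjoint_def, Submodule.codisjoint_iff_exists_add_eq]
  refine and_congr ⟨fun h a b h1 h2 => ?_, fun h => ?_⟩ ⟨fun h a b => ?_, fun h => ?_⟩
  · have h3 := h (a, b) h1 ⟨(b, -a), h2, by simp⟩
    exact ⟨congrArg Prod.fst h3, congrArg Prod.snd h3⟩
  · rintro ⟨a, b⟩ h1 ⟨⟨b', a'⟩, h2, h3⟩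
    simp only [LinearEquiv.coe_coe, LinearEquiv.skewSwap_apply, Prod.mk.injEq] at h3
    obtain ⟨rfl, rfl⟩ := h3
    have := h (-a') b' h1 (by simpa using h2)
    exact Prod.ext this.1 this.2
  · obtain ⟨⟨p, q⟩, _, h1, ⟨⟨p', q'⟩, h2, rfl⟩, h3⟩ := h (a, b)
    refine ⟨p, q, p', q', h1, h2, ?_, ?_⟩
    · simpa [sub_eq_add_neg] using (congrArg Prod.fst h3).symm
    · simpa using (congrArg Prod.snd h3).symm
  · rintro ⟨a, b⟩
    obtain ⟨p, q, p', q', h1, h2, rfl, rfl⟩ := h a b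
    exact ⟨(p, q), (-q', p'), h1, ⟨(p', q'), h2, by simp⟩, by simp [sub_eq_add_neg]⟩

theorem Submodule.projection_comm {M : Type*} [AddCommGroup M] [Module ℂ M] {K L : Submodule ℂ M}
    (h : IsCompl K L) (f : M →ₗ[ℂ] M) (hK : ∀ v ∈ K, f v ∈ K) (hL : ∀ v ∈ L, f v ∈ L) (v : M) :
    K.projection L h (f v) = f (K.projection L h v) := by
  obtain ⟨k, l, hk, hl, rfl⟩ := Submodule.codisjoint_iff_exists_add_eq.1 h.codisjoint v
  rw [map_add, map_add, map_add, map_add,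
    Submodule.projection_apply_left h ⟨k, hk⟩, Submodule.projection_apply_right h ⟨l, hl⟩,
    Submodule.projection_apply_left h ⟨f k, hK k hk⟩,
    Submodule.projection_apply_right h ⟨f l, hL l hl⟩, map_zero]

/-! ### Split boundary conditions and exactness -/

namespace QuantumGraph

variable (Γ : QuantumGraph.{u})

/-- The pairs of a family of values and a family of outgoing derivatives which satisfy the boundary
conditions. -/
noncomputable def boundarySpace : Submodule ℂ ((Γ.E × Bool → ℂ) × (Γ.E × Bool → ℂ)) where
  carrier := {p | ∀ x, Γ.BoundaryCondition x p.1 p.2}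
  add_mem' {p q} hp hq x := by
    have h := congrArg₂ (· + ·) (hp x) (hq x)
    simp only [add_zero] at h
    refine Eq.trans ?_ h
    have e1 : ∀ p q : Γ.E × Bool → ℂ, (fun d : Γ.EndsAt x => (p + q) d.1) =
      (fun d => p d.1) + fun d => q d.1 := fun _ _ => rfl
    simp only [Prod.fst_add, Prod.snd_add]
    rw [e1, e1, Matrix.mulVec_add, Matrix.mulVec_add]
    abel
  zero_mem' x := by
    have e1 : (fun d : Γ.EndsAt x => (0 : Γ.E × Bool → ℂ) d.1) = 0 := rfl
    simp only [BoundaryCondition, Prod.fst_zero, Prod.snd_zero, e1, Matrix.mulVec_zero, add_zero]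
  smul_mem' c p hp x := by
    have h := congrArg (c • ·) (hp x)
    simp only [smul_zero] at h
    refine Eq.trans ?_ h
    have e1 : ∀ p : Γ.E × Bool → ℂ, (fun d : Γ.EndsAt x => (c • p) d.1) =
      c • fun d : Γ.EndsAt x => p d.1 := fun _ => rfl
    simp only [Prod.smul_fst, Prod.smul_snd]
    rw [e1, e1, Matrix.mulVec_smul, Matrix.mulVec_smul, smul_add]

/-- The pairs of values and outgoing derivatives at a vertex which satisfy the boundary condition
there. -/
noncomputable def localSpace (x : Γ.V) : Submodule ℂ ((Γ.EndsAt x → ℂ) × (Γ.EndsAt x → ℂ)) :=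
  LinearMap.ker ((Γ.A x).mulVecLin.coprod (Γ.B x).mulVecLin)

theorem boundaryCondition_iff_mem_localSpace {x : Γ.V} {a b : Γ.E × Bool → ℂ} :
    Γ.BoundaryCondition x a b ↔
      ((fun d : Γ.EndsAt x => a d.1), fun d : Γ.EndsAt x => b d.1) ∈ Γ.localSpace x := Iff.rfl

/-- The space of boundary data is complementary to its image under rotation by a right angle, as
is the case for self-adjoint boundary conditions. -/
def IsSplit : Prop :=
  IsCompl Γ.boundarySpace
    (Γ.boundarySpace.map (LinearEquiv.skewSwap ℂ (Γ.E × Bool → ℂ) (Γ.E × Bool → ℂ)).toLinearMap)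

theorem isSplit_iff : Γ.IsSplit ↔
    (∀ a b, (a, b) ∈ Γ.boundarySpace → (b, -a) ∈ Γ.boundarySpace → a = 0 ∧ b = 0) ∧
      ∀ a b, ∃ p q p' q', (p, q) ∈ Γ.boundarySpace ∧ (p', q') ∈ Γ.boundarySpace ∧
        a = p - q' ∧ b = q + p' :=
  Submodule.isCompl_map_skewSwap_iff _

open Classical in
/-- The extension by zero of a function on the edge ends at a vertex. -/
noncomputable def extendByZero {Γ : QuantumGraph.{u}} {x : Γ.V} (a : Γ.EndsAt x → ℂ) :
    Γ.E × Bool → ℂ := fun d => if h : Γ.endpt d = x then a ⟨d, h⟩ else 0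

theorem extendByZero_coe {x : Γ.V} (a : Γ.EndsAt x → ℂ) (d : Γ.EndsAt x) :
    extendByZero a d.1 = a d := dif_pos d.2

theorem extendByZero_neg {x : Γ.V} (a : Γ.EndsAt x → ℂ) :
    extendByZero (-a) = -extendByZero a := by
  funext d
  by_cases hd : Γ.endpt d = x
  · rw [Pi.neg_apply, extendByZero, extendByZero, dif_pos hd, dif_pos hd]
    rfl
  · rw [Pi.neg_apply, extendByZero, extendByZero, dif_neg hd, dif_neg hd, neg_zero]

theorem extendByZero_mem {x : Γ.V} {a b : Γ.EndsAt x → ℂ} (h : (a, b) ∈ Γ.localSpace x) :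
    (extendByZero a, extendByZero b) ∈ Γ.boundarySpace := by
  intro y
  rw [boundaryCondition_iff_mem_localSpace]
  by_cases hxy : x = y
  · subst hxy
    simpa only [extendByZero_coe] using h
  · have h0 : ∀ (a : Γ.EndsAt x → ℂ) (d : Γ.EndsAt y), extendByZero a d.1 = 0 := fun a d =>
      dif_neg fun hd => hxy (hd.symm.trans d.2)
    simp only [h0]
    exact Submodule.zero_mem _

/-- Each edge end lies at exactly one vertex, so the boundary space is the product of the local
spaces. The global form suits group actions and subdivisions, the local form dimension counts. -/
theorem isSplit_iff_local : Γ.IsSplit ↔ ∀ x, IsCompl (Γ.localSpace x) ((Γ.localSpace x).map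
    (LinearEquiv.skewSwap ℂ (Γ.EndsAt x → ℂ) (Γ.EndsAt x → ℂ)).toLinearMap) := by
  simp only [Submodule.isCompl_map_skewSwap_iff, isSplit_iff]
  constructor
  · rintro ⟨h1, h2⟩ x
    refine ⟨fun a b hab hba => ?_, fun a b => ?_⟩
    · have h3 := h1 _ _ (Γ.extendByZero_mem hab) (Γ.extendByZero_neg a ▸ Γ.extendByZero_mem hba)
      refine ⟨funext fun d => ?_, funext fun d => ?_⟩
      · rw [← Γ.extendByZero_coe a, h3.1]
        rfl
      · rw [← Γ.extendByZero_coe b, h3.2]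
        rfl
    · obtain ⟨p, q, p', q', h3, h4, h5, h6⟩ := h2 (extendByZero a) (extendByZero b)
      refine ⟨_, _, _, _, h3 x, h4 x, funext fun d => ?_, funext fun d => ?_⟩
      · rw [← Γ.extendByZero_coe a, h5]
        rfl
      · rw [← Γ.extendByZero_coe b, h6]
        rfl
  · intro h
    refine ⟨fun a b hab hba => ?_, fun a b => ?_⟩
    · have h1 := fun x => (h x).1 _ _ (hab x) (hba x)
      refine ⟨funext fun d => ?_, funext fun d => ?_⟩
      · have h2 := congrFun (h1 (Γ.endpt d)).1 ⟨d, rfl⟩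
        exact h2
      · have h2 := congrFun (h1 (Γ.endpt d)).2 ⟨d, rfl⟩
        exact h2
    · have h1 := fun x => (h x).2 (fun d => a d.1) (fun d => b d.1)
      choose p q p' q' h3 h4 h5 h6 using h1
      -- Glued local data restrict back to the given ones; the vertex `Γ.endpt d` equals `x` only
      -- propositionally.
      have hr : ∀ (P : ∀ x, Γ.EndsAt x → ℂ) (x : Γ.V),
          (fun d : Γ.EndsAt x => P (Γ.endpt d.1) ⟨d.1, rfl⟩) = P x := by
        intro P x
        funext d
        obtain ⟨d, hd⟩ := d
        subst hd
        rfl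
      refine ⟨fun d => p _ ⟨d, rfl⟩, fun d => q _ ⟨d, rfl⟩, fun d => p' _ ⟨d, rfl⟩,
        fun d => q' _ ⟨d, rfl⟩, fun x => ?_, fun x => ?_, funext fun d => ?_, funext fun d => ?_⟩
      · rw [boundaryCondition_iff_mem_localSpace]
        simp only [hr p, hr q]
        exact h3 x
      · rw [boundaryCondition_iff_mem_localSpace]
        simp only [hr p', hr q']
        exact h4 x
      · exact congrFun (h5 (Γ.endpt d)) ⟨d, rfl⟩
      · exact congrFun (h6 (Γ.endpt d)) ⟨d, rfl⟩

theorem rankAt_add_finrank (x : Γ.V) :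
    Γ.rankAt x + Module.finrank ℂ (Γ.localSpace x) = 2 * Γ.degree x := by
  have h1 : LinearMap.range ((Γ.A x).mulVecLin.coprod (Γ.B x).mulVecLin) =
      LinearMap.range (Matrix.fromCols (Γ.A x) (Γ.B x)).mulVecLin := by
    ext v
    constructor
    · rintro ⟨⟨a, b⟩, rfl⟩
      exact ⟨Sum.elim a b, by simp⟩
    · rintro ⟨c, rfl⟩
      exact ⟨(c ∘ Sum.inl, c ∘ Sum.inr), by simp [Matrix.fromCols_mulVec]⟩
  have h2 := LinearMap.finrank_range_add_finrank_ker
    ((Γ.A x).mulVecLin.coprod (Γ.B x).mulVecLin)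
  rw [h1, Module.finrank_prod, Module.finrank_fintype_fun_eq_card] at h2
  rw [rankAt, Matrix.rank, localSpace, h2, MetricGraph.degree, Nat.card_eq_fintype_card, two_mul]

theorem isExact_iff : Γ.IsExact ↔ ∀ x, Module.finrank ℂ (Γ.localSpace x) = Γ.degree x :=
  forall_congr' fun x => by
    have := Γ.rankAt_add_finrank x
    omega

theorem finrank_map_skewSwap (x : Γ.V) : Module.finrank ℂ ((Γ.localSpace x).map
    (LinearEquiv.skewSwap ℂ (Γ.EndsAt x → ℂ) (Γ.EndsAt x → ℂ)).toLinearMap) =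
      Module.finrank ℂ (Γ.localSpace x) :=
  LinearEquiv.finrank_map_eq _ _

theorem finrank_boundaryData (x : Γ.V) :
    Module.finrank ℂ ((Γ.EndsAt x → ℂ) × (Γ.EndsAt x → ℂ)) = 2 * Γ.degree x := by
  rw [Module.finrank_prod, Module.finrank_fintype_fun_eq_card, MetricGraph.degree,
    Nat.card_eq_fintype_card, two_mul]

variable {Γ} in
-- The local space and its rotation have equal dimension and together fill a space of dimension
-- twice the degree; rank and nullity give the rest.
theorem IsSplit.isExact (h : Γ.IsSplit) : Γ.IsExact := by
  rw [isExact_iff]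
  intro x
  have h1 := Submodule.finrank_add_eq_of_isCompl (Γ.isSplit_iff_local.1 h x)
  rw [finrank_map_skewSwap, finrank_boundaryData] at h1
  omega

namespace Action.Choices

variable {Γ} {G : Type v} [Group G] [Finite G] {act : Γ.Action G}
  {W : Type w} [AddCommGroup W] [Module ℂ W] {R : Representation ℂ G W} (C : act.Choices R)

/-- Data on the quotient are extended to equivariant families on `Γ` and decomposed there for each
`r`. The boundary space and its rotation are `G`-stable, so the components are again equivariant
families and come from the quotient. -/
theorem isSplit_graph (hN : act.NoNeighbours) (hS : Γ.IsSplit) : C.graph.IsSplit := by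
  suffices h : (∀ a b : C.metricGraph.E × Bool → ℂ, (∀ x, C.graph.BoundaryCondition x a b) →
      (∀ x, C.graph.BoundaryCondition x b (-a)) → a = 0 ∧ b = 0) ∧
      ∀ a b : C.metricGraph.E × Bool → ℂ, ∃ p q p' q' : C.metricGraph.E × Bool → ℂ,
        (∀ x, C.graph.BoundaryCondition x p q) ∧ (∀ x, C.graph.BoundaryCondition x p' q') ∧
          a = p - q' ∧ b = q + p' from C.graph.isSplit_iff.2 h
  constructor
  · intro a b hab hba
    have h1 := (C.forall_boundaryCondition_graph_iff hN a b).1 hab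
    have h2 := (C.forall_boundaryCondition_graph_iff hN b (-a)).1 hba
    simp only [extend_neg, LinearMap.neg_apply] at h2
    have h3 := fun r => (Γ.isSplit_iff.1 hS).1 (fun d => C.extend a d r)
      (fun d => C.extend b d r) (h1 r) (h2 r)
    refine ⟨funext fun c => ?_, funext fun c => ?_⟩
    · rw [← C.extend_basis hN a c]
      exact congrFun (h3 _).1 _
    · rw [← C.extend_basis hN b c]
      exact congrFun (h3 _).2 _
  · intro a b
    let π := Γ.boundarySpace.projection _ hS
    let F : W →ₗ[ℂ] (Γ.E × Bool → ℂ) × (Γ.E × Bool → ℂ) :=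
      (LinearMap.pi (C.extend a)).prod (LinearMap.pi (C.extend b))
    let σ : G → ((Γ.E × Bool → ℂ) × (Γ.E × Bool → ℂ)) →ₗ[ℂ]
        (Γ.E × Bool → ℂ) × (Γ.E × Bool → ℂ) := fun g =>
      (LinearMap.funLeft ℂ ℂ (act.onEnds g)).prodMap (LinearMap.funLeft ℂ ℂ (act.onEnds g))
    have hσ : ∀ g v, v ∈ Γ.boundarySpace → σ g v ∈ Γ.boundarySpace := fun g v hv x =>
      (act.boundaryCondition_iff g x v.1 v.2).1 (hv _)
    have hπ : ∀ g v, π (σ g v) = σ g (π v) := fun g v =>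
      Submodule.projection_comm hS (σ g) (hσ g) (by
        rintro _ ⟨v, hv, rfl⟩
        exact ⟨σ g v, hσ g v hv, rfl⟩) v
    have hF : ∀ g r, σ g (F (R g r)) = F r := fun g r =>
      Prod.ext (funext fun d => C.extend_onEnds hN a g d r)
        (funext fun d => C.extend_onEnds hN b g d r)
    have hP : ∀ g r, σ g (π (F (R g r))) = π (F r) := fun g r => by rw [← hπ, hF]
    obtain ⟨p, hp⟩ : ∃ p, ∀ d r, (π (F r)).1 d = C.extend p d r := by
      have := C.eq_extend hN (F := fun d => LinearMap.proj d ∘ₗ LinearMap.fst ℂ _ _ ∘ₗ π ∘ₗ F)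
        fun g d r => congrFun (congrArg Prod.fst (hP g r)) d
      exact ⟨_, fun d r => LinearMap.congr_fun (congrFun this d) r⟩
    obtain ⟨q, hq⟩ : ∃ q, ∀ d r, (π (F r)).2 d = C.extend q d r := by
      have := C.eq_extend hN (F := fun d => LinearMap.proj d ∘ₗ LinearMap.snd ℂ _ _ ∘ₗ π ∘ₗ F)
        fun g d r => congrFun (congrArg Prod.snd (hP g r)) d
      exact ⟨_, fun d r => LinearMap.congr_fun (congrFun this d) r⟩
    -- The last two are forced by `a = p - q'` and `b = q + p'`. They encode the component in the
    -- rotated space, since `(a - p, b - q)` is the rotation of `(b - q, p - a)`.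
    refine ⟨p, q, b - q, p - a, ?_, ?_, by abel, by abel⟩
    · refine (C.forall_boundaryCondition_graph_iff hN p q).2 fun r y => ?_
      have h := Submodule.projection_apply_mem hS (F r) y
      change Γ.BoundaryCondition y (π (F r)).1 (π (F r)).2 at h
      rwa [show (π (F r)).1 = _ from funext fun d => hp d r,
        show (π (F r)).2 = _ from funext fun d => hq d r] at h
    · refine (C.forall_boundaryCondition_graph_iff hN _ _).2 fun r y => ?_
      have h : F r - π (F r) ∈ _ := Submodule.sub_projection_mem hS (F r)
      obtain ⟨⟨s, t⟩, hst, h⟩ := h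
      simp only [LinearEquiv.coe_coe, LinearEquiv.skewSwap_apply] at h
      have h1 : t = fun d => C.extend (p - a) d r := by
        funext d
        have := congrFun (congrArg Prod.fst h) d
        simp only [Pi.neg_apply, Prod.fst_sub, Pi.sub_apply, hp] at this
        rw [sub_eq_add_neg, extend_add, extend_neg]
        have h2 : (F r).1 d = C.extend a d r := rfl
        rw [h2] at this
        simp only [LinearMap.add_apply, LinearMap.neg_apply]
        linear_combination -this
      have h2 : s = fun d => C.extend (b - q) d r := by
        funext d
        have := congrFun (congrArg Prod.snd h) d
        simp only [Prod.snd_sub, Pi.sub_apply, hq] at this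
        rw [sub_eq_add_neg, extend_add, extend_neg]
        have h2 : (F r).2 d = C.extend b d r := rfl
        rw [h2] at this
        simp only [LinearMap.add_apply, LinearMap.neg_apply]
        linear_combination this
      rw [← h1, ← h2]
      exact hst y

end Action.Choices

end QuantumGraph

/-! ### Green's formula and prescribed boundary data -/

namespace MetricGraph

variable (Γ : MetricGraph.{u})

theorem derivWithin_along (f : Γ.E → ℝ → ℂ) (d : Γ.E × Bool) (t : ℝ) :
    derivWithin (Γ.along f d) (Γ.seg d.1) t =
      (if d.2 then -1 else 1 : ℂ) * derivWithin (f d.1) (Γ.seg d.1) (Γ.coord d t) := by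
  rcases d with ⟨e, _ | _⟩
  · change derivWithin (fun s => f e (Γ.coord (e, false) s)) (Γ.seg e) t = _
    simp [coord]
  · change derivWithin (fun s => f e (Γ.coord (e, true) s)) (Γ.seg e) t = _
    simp [coord, seg, derivWithin_comp_const_sub]

theorem value_false (f : Γ.E → ℝ → ℂ) (e : Γ.E) : Γ.value f (e, false) = f e 0 := rfl

theorem value_true (f : Γ.E → ℝ → ℂ) (e : Γ.E) : Γ.value f (e, true) = f e (Γ.len e) := by
  simp [value, along, coord]

theorem outDeriv_false (f : Γ.E → ℝ → ℂ) (e : Γ.E) :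
    Γ.outDeriv f (e, false) = derivWithin (f e) (Γ.seg e) 0 := rfl

theorem outDeriv_true (f : Γ.E → ℝ → ℂ) (e : Γ.E) :
    Γ.outDeriv f (e, true) = -derivWithin (f e) (Γ.seg e) (Γ.len e) := by
  rw [outDeriv, derivWithin_along]
  simp [coord]

theorem len_mem_seg (e : Γ.E) : Γ.len e ∈ Γ.seg e := ⟨(Γ.len_pos e).le, le_rfl⟩

/-- The restriction of a family of smooth functions on the line to the edges. -/
noncomputable def ofFamily (F : Γ.E → ℝ → ℂ) (hF : ∀ e, ContDiff ℝ ∞ (F e)) : Γ.Smooth :=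
  ⟨fun e => (Γ.seg e).indicator (F e), fun e => ⟨(hF e).contDiffOn.congr fun _ ht =>
    indicator_of_mem ht _, fun _ ht => indicator_of_notMem ht _⟩⟩

theorem ofFamily_apply {F : Γ.E → ℝ → ℂ} (hF : ∀ e, ContDiff ℝ ∞ (F e)) {e : Γ.E} {t : ℝ}
    (ht : t ∈ Γ.seg e) : (Γ.ofFamily F hF).1 e t = F e t := indicator_of_mem ht _

theorem derivWithin_ofFamily {F : Γ.E → ℝ → ℂ} (hF : ∀ e, ContDiff ℝ ∞ (F e)) {e : Γ.E} {t : ℝ}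
    (ht : t ∈ Γ.seg e) {c : ℂ} (hc : HasDerivAt (F e) c t) :
    derivWithin ((Γ.ofFamily F hF).1 e) (Γ.seg e) t = c := by
  rw [derivWithin_congr (fun t ht => Γ.ofFamily_apply hF ht) (Γ.ofFamily_apply hF ht)]
  exact hc.hasDerivWithinAt.derivWithin (Γ.uniqueDiffOn_seg e t ht)

/-- Values and outgoing derivatives at the edge ends can be prescribed. -/
theorem exists_smooth (a b : Γ.E × Bool → ℂ) :
    ∃ f : Γ.Smooth, Γ.value f.1 = a ∧ Γ.outDeriv f.1 = b := by
  have H : ∀ e, ∃ P : ℝ → ℂ, ContDiff ℝ ∞ P ∧ P 0 = a (e, false) ∧ P (Γ.len e) = a (e, true) ∧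
      HasDerivAt P (b (e, false)) 0 ∧ HasDerivAt P (-b (e, true)) (Γ.len e) := by
    intro e
    have hl : (Γ.len e : ℂ) ≠ 0 := Complex.ofReal_ne_zero.2 (Γ.len_pos e).ne'
    obtain ⟨l, hl'⟩ : ∃ l : ℂ, l = (Γ.len e : ℂ) := ⟨_, rfl⟩
    rw [← hl'] at hl
    -- Cubic Hermite interpolation: `s` and `m` are the value and the slope that the quadratic and
    -- cubic terms must contribute at the far end. The outgoing derivative there is minus the
    -- derivative in the coordinate.
    set s : ℂ := a (e, true) - a (e, false) - b (e, false) * l with hs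
    set m : ℂ := -b (e, true) - b (e, false) with hm
    have hd : ∀ t : ℝ, HasDerivAt (fun t : ℝ => a (e, false) + b (e, false) * (t : ℂ) +
        (3 * s - m * l) / l ^ 2 * (t : ℂ) ^ 2 + (m * l - 2 * s) / l ^ 3 * (t : ℂ) ^ 3)
        (b (e, false) + (3 * s - m * l) / l ^ 2 * (2 * (t : ℂ)) +
          (m * l - 2 * s) / l ^ 3 * (3 * (t : ℂ) ^ 2)) t := by
      intro t
      have h1 : HasDerivAt (fun t : ℝ => (t : ℂ)) 1 t := Complex.ofRealCLM.hasDerivAt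
      refine ((((h1.const_mul (b (e, false))).const_add (a (e, false))).add
        ((h1.pow 2).const_mul ((3 * s - m * l) / l ^ 2))).add
        ((h1.pow 3).const_mul ((m * l - 2 * s) / l ^ 3))).congr_deriv ?_
      norm_num
    refine ⟨_, ?_, ?_, ?_, (hd 0).congr_deriv ?_, (hd (Γ.len e)).congr_deriv ?_⟩
    · have h1 : ContDiff ℝ ∞ (fun t : ℝ => (t : ℂ)) := Complex.ofRealCLM.contDiff
      exact ((contDiff_const.add (contDiff_const.mul h1)).add
        (contDiff_const.mul (h1.pow 2))).add (contDiff_const.mul (h1.pow 3))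
    · simp
    · simp only [← hl']
      field_simp
      rw [hs]
      ring
    · simp
    · simp only [← hl']
      field_simp
      rw [hs, hm]
      ring
  choose P h1 h2 h3 h4 h5 using H
  refine ⟨Γ.ofFamily P h1, funext ?_, funext ?_⟩
  · rintro ⟨e, _ | _⟩
    · rw [value_false, Γ.ofFamily_apply h1 (Γ.zero_mem_seg e), h2]
    · rw [value_true, Γ.ofFamily_apply h1 (Γ.len_mem_seg e), h3]
  · rintro ⟨e, _ | _⟩
    · rw [outDeriv_false, Γ.derivWithin_ofFamily h1 (Γ.zero_mem_seg e) (h4 e)]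
    · rw [outDeriv_true, Γ.derivWithin_ofFamily h1 (Γ.len_mem_seg e) (h5 e), neg_neg]

theorem inner_toL2 (f g : Γ.Smooth) :
    inner ℂ (Γ.toL2 f) (Γ.toL2 g) = ∑ e, ∫ t in (0 : ℝ)..Γ.len e, star (f.1 e t) * g.1 e t := by
  rw [PiLp.inner_apply]
  refine Finset.sum_congr rfl fun e _ => ?_
  rw [MeasureTheory.L2.inner_def, intervalIntegral.integral_of_le (Γ.len_pos e).le,
    ← integral_Icc_eq_integral_Ioc]
  refine integral_congr_ae ?_
  filter_upwards [(Γ.memLp_smooth f e).coeFn_toLp, (Γ.memLp_smooth g e).coeFn_toLp] with t h1 h2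
  change inner ℂ ((Γ.memLp_smooth f e).toLp (f.1 e) t) ((Γ.memLp_smooth g e).toLp (g.1 e) t) = _
  rw [h1, h2, RCLike.inner_apply, mul_comm]
  rfl

theorem laplacian_apply (f : Γ.Smooth) {e : Γ.E} {t : ℝ} (ht : t ∈ Γ.seg e) :
    (Γ.laplacian f).1 e t = -Γ.secondDeriv f.1 e t :=
  indicator_of_mem ht fun t => -Γ.secondDeriv f.1 e t

theorem hasDerivWithinAt (f : Γ.Smooth) {e : Γ.E} {t : ℝ} (ht : t ∈ Γ.seg e) :
    HasDerivWithinAt (f.1 e) (derivWithin (f.1 e) (Γ.seg e) t) (Γ.seg e) t :=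
  ((f.2 e).1.differentiableOn (by simp) t ht).hasDerivWithinAt

theorem hasDerivWithinAt_derivWithin (f : Γ.Smooth) {e : Γ.E} {t : ℝ} (ht : t ∈ Γ.seg e) :
    HasDerivWithinAt (derivWithin (f.1 e) (Γ.seg e)) (Γ.secondDeriv f.1 e t) (Γ.seg e) t :=
  ((contDiffOn_derivWithin (Γ.uniqueDiffOn_seg e) (f.2 e).1).differentiableOn
    (by simp) t ht).hasDerivWithinAt

/-- Integration by parts: `f̄ g' - f̄' g` is a primitive of the difference of the integrands. -/
theorem integral_laplacian (f g : Γ.Smooth) (e : Γ.E) :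
    (∫ t in (0 : ℝ)..Γ.len e, star ((Γ.laplacian f).1 e t) * g.1 e t) -
      ∫ t in (0 : ℝ)..Γ.len e, star (f.1 e t) * (Γ.laplacian g).1 e t =
    ∑ b : Bool, (star (Γ.outDeriv f.1 (e, b)) * Γ.value g.1 (e, b) -
      star (Γ.value f.1 (e, b)) * Γ.outDeriv g.1 (e, b)) := by
  have hle := (Γ.len_pos e).le
  have hcont : ∀ k : Γ.Smooth, ContinuousOn (k.1 e) (Icc 0 (Γ.len e)) := fun k =>
    (k.2 e).1.continuousOn
  have hint : ∀ h k : Γ.Smooth, IntervalIntegrable (fun t => star (h.1 e t) * k.1 e t)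
      volume 0 (Γ.len e) := fun h k =>
    ContinuousOn.intervalIntegrable_of_Icc hle ((hcont h).star.mul (hcont k))
  have hd : ∀ t ∈ Γ.seg e, HasDerivWithinAt (fun t => star (f.1 e t) *
      derivWithin (g.1 e) (Γ.seg e) t - star (derivWithin (f.1 e) (Γ.seg e) t) * g.1 e t)
      (star ((Γ.laplacian f).1 e t) * g.1 e t - star (f.1 e t) * (Γ.laplacian g).1 e t)
      (Γ.seg e) t := by
    intro t ht
    refine (((Γ.hasDerivWithinAt f ht).star.mul (Γ.hasDerivWithinAt_derivWithin g ht)).sub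
      ((Γ.hasDerivWithinAt_derivWithin f ht).star.mul (Γ.hasDerivWithinAt g ht))).congr_deriv ?_
    rw [Γ.laplacian_apply f ht, Γ.laplacian_apply g ht, star_neg]
    ring
  rw [← intervalIntegral.integral_sub (hint _ _) (hint _ _),
    intervalIntegral.integral_eq_sub_of_hasDerivAt_of_le hle
      (fun t ht => (hd t ht).continuousWithinAt)
      (fun t ht => (hd t (Ioo_subset_Icc_self ht)).hasDerivAt (Icc_mem_nhds ht.1 ht.2))
      ((hint _ _).sub (hint _ _))]
  rw [Fintype.sum_bool, outDeriv_true, outDeriv_true, outDeriv_false, outDeriv_false, value_true,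
    value_true, value_false, value_false, star_neg]
  ring

end MetricGraph

/-! ### Self-adjoint Laplacians have split boundary conditions -/

namespace QuantumGraph

variable {Γ : QuantumGraph.{u}}

theorem laplacianL2_apply {f : Γ.Smooth} (hf : f ∈ Γ.SmoothBC)
    (h : Γ.toL2 f ∈ Γ.laplacianL2.domain) :
    Γ.laplacianL2 ⟨Γ.toL2 f, h⟩ = Γ.toL2 (Γ.laplacian f) := by
  have h1 : (Γ.SmoothBC.equivMapOfInjective Γ.toL2 Γ.toL2_injective).symm ⟨Γ.toL2 f, h⟩ =
      ⟨f, hf⟩ := by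
    rw [LinearEquiv.symm_apply_eq]
    rfl
  change Γ.toL2 (Γ.laplacian (((Γ.SmoothBC.equivMapOfInjective Γ.toL2
    Γ.toL2_injective).symm ⟨Γ.toL2 f, h⟩ : Γ.SmoothBC) : Γ.Smooth)) = _
  rw [h1]

/-- A self-adjoint closure is formally adjoint to itself, and it extends the Laplacian on smooth
functions. Only this symmetry is used of self-adjointness. -/
theorem LaplacianIsSelfAdjoint.symmetric (hS : Γ.LaplacianIsSelfAdjoint) {f g : Γ.Smooth}
    (hf : f ∈ Γ.SmoothBC) (hg : g ∈ Γ.SmoothBC) :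
    inner ℂ (Γ.toL2 (Γ.laplacian f)) (Γ.toL2 g) = inner ℂ (Γ.toL2 f) (Γ.toL2 (Γ.laplacian g)) := by
  have h1 := LinearPMap.adjoint_isFormalAdjoint (IsSelfAdjoint.dense_domain hS)
  rw [LinearPMap.isSelfAdjoint_def.1 hS] at h1
  have hle := Γ.laplacianL2.le_closure
  have key : ∀ {k : Γ.Smooth}, k ∈ Γ.SmoothBC → ∃ h : Γ.toL2 k ∈ Γ.laplacianL2.closure.domain,
      Γ.laplacianL2.closure ⟨Γ.toL2 k, h⟩ = Γ.toL2 (Γ.laplacian k) := fun {k} hk =>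
    have hd : Γ.toL2 k ∈ Γ.laplacianL2.domain := Submodule.mem_map_of_mem hk
    ⟨hle.1 hd, (hle.2 (x := ⟨Γ.toL2 k, hd⟩) rfl).symm.trans (laplacianL2_apply hk hd)⟩
  obtain ⟨hf1, hf2⟩ := key hf
  obtain ⟨hg1, hg2⟩ := key hg
  have h2 := h1 ⟨_, hf1⟩ ⟨_, hg1⟩
  rwa [hf2, hg2] at h2

/-- All boundary data are realized by smooth functions, so the boundary terms in Green's formula
must cancel on the whole boundary space. -/
theorem LaplacianIsSelfAdjoint.isotropic (hS : Γ.LaplacianIsSelfAdjoint)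
    {a b a' b' : Γ.E × Bool → ℂ} (h : (a, b) ∈ Γ.boundarySpace) (h' : (a', b') ∈ Γ.boundarySpace) :
    ∑ d, (star (b d) * a' d - star (a d) * b' d) = 0 := by
  obtain ⟨f, rfl, rfl⟩ := Γ.exists_smooth a b
  obtain ⟨g, rfl, rfl⟩ := Γ.exists_smooth a' b'
  have h1 := hS.symmetric (f := f) (g := g) h h'
  rw [Γ.inner_toL2, Γ.inner_toL2, ← sub_eq_zero, ← Finset.sum_sub_distrib] at h1
  rw [Fintype.sum_prod_type, ← h1]
  exact Finset.sum_congr rfl fun e _ => (Γ.integral_laplacian f g e).symm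

/-- The boundary form of `(a, b)` and `(b, -a)` is the sum of all `|a d|² + |b d|²`. -/
theorem LaplacianIsSelfAdjoint.eq_zero (hS : Γ.LaplacianIsSelfAdjoint) {a b : Γ.E × Bool → ℂ}
    (h : (a, b) ∈ Γ.boundarySpace) (h' : (b, -a) ∈ Γ.boundarySpace) : a = 0 ∧ b = 0 := by
  have h1 := hS.isotropic h h'
  have h2 : ∀ d, star (b d) * b d - star (a d) * (-a) d =
      ((Complex.normSq (b d) + Complex.normSq (a d) : ℝ) : ℂ) := by
    intro d
    rw [Pi.neg_apply, Complex.ofReal_add, Complex.normSq_eq_conj_mul_self,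
      Complex.normSq_eq_conj_mul_self, starRingEnd_apply, starRingEnd_apply]
    ring
  simp only [h2] at h1
  rw [← Complex.ofReal_sum, Complex.ofReal_eq_zero, Finset.sum_eq_zero_iff_of_nonneg fun d _ =>
    add_nonneg (Complex.normSq_nonneg _) (Complex.normSq_nonneg _)] at h1
  refine ⟨funext fun d => ?_, funext fun d => ?_⟩
  · have := h1 d (Finset.mem_univ _)
    exact Complex.normSq_eq_zero.1 (by
      linarith [Complex.normSq_nonneg (b d), Complex.normSq_nonneg (a d)])
  · have := h1 d (Finset.mem_univ _)
    exact Complex.normSq_eq_zero.1 (by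
      linarith [Complex.normSq_nonneg (b d), Complex.normSq_nonneg (a d)])

/-- Disjointness comes from the boundary form, applied to local data extended by zero. Properness
bounds the rank by the degree, so each local space has at least half of the full dimension, and a
disjoint pair of such spaces is complementary. -/
theorem LaplacianIsSelfAdjoint.isSplit (hS : Γ.LaplacianIsSelfAdjoint) (hP : Γ.IsProper) :
    Γ.IsSplit := by
  rw [isSplit_iff_local]
  intro x
  have hdisj : Disjoint (Γ.localSpace x) ((Γ.localSpace x).map
      (LinearEquiv.skewSwap ℂ (Γ.EndsAt x → ℂ) (Γ.EndsAt x → ℂ)).toLinearMap) := by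
    rw [Submodule.disjoint_def]
    rintro ⟨a, b⟩ h1 ⟨⟨b', a'⟩, h2, h3⟩
    simp only [LinearEquiv.coe_coe, LinearEquiv.skewSwap_apply, Prod.mk.injEq] at h3
    obtain ⟨rfl, rfl⟩ := h3
    have h4 : (extendByZero a', -extendByZero b') ∈ Γ.boundarySpace := by
      have h := Submodule.neg_mem _ (Γ.extendByZero_mem h1)
      rwa [extendByZero_neg, Prod.neg_mk, neg_neg] at h
    have h5 := hS.eq_zero (Γ.extendByZero_mem h2) h4
    refine Prod.ext (funext fun d => ?_) (funext fun d => ?_)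
    · change -(a' d) = 0
      rw [← Γ.extendByZero_coe a', h5.2, Pi.zero_apply, neg_zero]
    · change b' d = 0
      rw [← Γ.extendByZero_coe b', h5.1, Pi.zero_apply]
  have hrank : Γ.rankAt x ≤ Γ.degree x := by
    have := Γ.finite_Row x
    let := Fintype.ofFinite (Γ.Row x)
    rw [← hP x, Nat.card_eq_fintype_card]
    exact Matrix.rank_le_card_height _
  have h1 := Γ.rankAt_add_finrank x
  have h2 := Submodule.finrank_add_finrank_le_of_disjoint hdisj
  rw [finrank_map_skewSwap, finrank_boundaryData] at h2
  refine ⟨hdisj, codisjoint_iff.2 (Submodule.eq_top_of_disjoint _ _ ?_ hdisj)⟩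
  rw [finrank_map_skewSwap, finrank_boundaryData]
  omega

end QuantumGraph

/-! ### The encoding map -/

namespace QuantumGraph

variable {Γ : QuantumGraph.{u}}

theorem mem_Eig_iff {μ : ℂ} {f : Γ.Smooth} :
    f ∈ Γ.Eig μ ↔ f ∈ Γ.SmoothBC ∧ Γ.laplacian f = μ • f := by
  rw [Eig, Submodule.mem_inf, Module.End.mem_eigenspace_iff]

namespace Action

variable {G : Type v} [Group G] {act : Γ.Action G}
  {W : Type w} [AddCommGroup W] [Module ℂ W] {R : Representation ℂ G W}

theorem along_onEnds (f : R.IntertwiningMap act.smoothRep) (g : G) (d : Γ.E × Bool) (r : W) :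
    Γ.along (f (R g r)).1 (act.onEnds g d) = Γ.along (f r).1 d := by
  rw [f.isIntertwining, coe_smoothRep, along_transport, act.onEnds_inv_onEnds]

theorem outDeriv_onEnds (f : R.IntertwiningMap act.smoothRep) (g : G) (d : Γ.E × Bool) (r : W) :
    Γ.outDeriv (f (R g r)).1 (act.onEnds g d) = Γ.outDeriv (f r).1 d := by
  rw [MetricGraph.outDeriv, along_onEnds, act.seg_onEnds]
  rfl

namespace Choices

variable (C : act.Choices R)

/-- The encoding map, on equivariant maps into the smooth functions. -/
noncomputable def encode :
    R.IntertwiningMap act.smoothRep →ₗ[ℂ] C.metricGraph.Smooth where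
  toFun f := ⟨fun p => (f (C.edgeBasis p.1.1 p.1.2)).1 p.1.1,
    fun p => (f (C.edgeBasis p.1.1 p.1.2)).2 p.1.1⟩
  map_add' _ _ := rfl
  map_smul' _ _ := rfl

theorem laplacian_encode (f k : R.IntertwiningMap act.smoothRep)
    (h : ∀ r, k r = Γ.laplacian (f r)) :
    C.metricGraph.laplacian (C.encode f) = C.encode k := by
  ext p t
  change _ = (k (C.edgeBasis p.1.1 p.1.2)).1 p.1.1 t
  rw [h]
  rfl

theorem extend_apply_apply (u : C.metricGraph.E × Bool → ℝ → ℂ) (d : Γ.E × Bool) (r : W)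
    (t : ℝ) : C.extend u d r t = C.extend (fun c => u c t) d r :=
  C.map_extend (LinearMap.proj t : (ℝ → ℂ) →ₗ[ℂ] ℂ) u d r

/-- Needed for the equivariance of `decode`: an element of `G` may reverse the coordinate when it
maps one edge to another. -/
theorem extend_along_flip (φ : C.metricGraph.Smooth) (d : Γ.E × Bool) (r : W) (t : ℝ) :
    C.extend (C.metricGraph.along φ.1) (MetricGraph.flip d) r t =
      C.extend (C.metricGraph.along φ.1) d r (Γ.len d.1 - t) := by
  rw [extend_apply_apply, extend_apply_apply, extend_apply, extend_apply]
  refine Finset.sum_congr rfl fun p _ => ?_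
  have hf : (MetricGraph.flip d).1 = d.1 := rfl
  rw [hf, act.onEnds_flip]
  split_ifs with hp
  · congr 1
    refine (C.metricGraph.along_flip φ.1 (p, (act.onEnds (C.carry d.1)⁻¹ d).2) t).trans ?_
    have hl : C.metricGraph.len p = Γ.len d.1 := by
      change Γ.len p.1.1 = Γ.len d.1
      rw [hp, ← C.fst_onEnds_carry_inv, act.len_onEnds]
    rw [hl]
  · rfl

theorem extend_along_mem (φ : C.metricGraph.Smooth) (r : W) :
    (fun e => C.extend (C.metricGraph.along φ.1) (e, false) r) ∈ Γ.Smooth := by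
  intro e
  have hseg : ∀ p : C.metricGraph.E, p.1.1 = C.repE e → C.metricGraph.seg p = Γ.seg e := by
    intro p hp
    change Icc 0 (Γ.len p.1.1) = Icc 0 (Γ.len e)
    rw [hp, ← C.fst_onEnds_carry_inv (e, false), act.len_onEnds]
  refine ⟨?_, fun t ht => ?_⟩
  · have h := funext fun t => (C.extend_apply_apply (C.metricGraph.along φ.1) (e, false) r t).trans
      (C.extend_apply _ _ _)
    change ContDiffOn ℝ ∞ (C.extend (C.metricGraph.along φ.1) (e, false) r) _
    rw [h]
    refine ContDiffOn.sum fun p _ => ?_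
    split_ifs with hp
    · rw [← hseg p hp]
      exact (C.metricGraph.contDiffOn_along φ _).const_smul _
    · exact contDiffOn_const
  · refine (C.extend_apply_apply _ (e, false) r t).trans ?_
    rw [extend_apply]
    refine Finset.sum_eq_zero fun p _ => ?_
    split_ifs with hp
    · rw [← hseg p hp] at ht
      rw [MetricGraph.along, (φ.2 p).2 _ fun h => ht
        ((C.metricGraph.coord_mem_seg _ _).1 h), smul_zero]
    · rfl

section

variable [Finite G]

/-- The restrictions of `f r` to the edges, measured from each end, form an equivariant family with
values in functions, and the encoding consists of its values on the basis vectors. So the encoding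
determines `f`. -/
theorem along_eq_extend (hN : act.NoNeighbours) (f : R.IntertwiningMap act.smoothRep)
    (d : Γ.E × Bool) (r : W) :
    Γ.along (f r).1 d = C.extend (C.metricGraph.along (C.encode f).1) d r := by
  let F : Γ.E × Bool → W →ₗ[ℂ] ℝ → ℂ := fun d =>
    { toFun := fun r => Γ.along (f r).1 d
      map_add' := fun r s => by rw [map_add]; rfl
      map_smul' := fun c r => by rw [map_smul]; rfl }
  have h := C.eq_extend hN (F := F) fun g d r => along_onEnds f g d r
  exact LinearMap.congr_fun (congrFun h d) r

theorem value_eq_extend (hN : act.NoNeighbours) (f : R.IntertwiningMap act.smoothRep)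
    (d : Γ.E × Bool) (r : W) :
    Γ.value (f r).1 d = C.extend (C.metricGraph.value (C.encode f).1) d r := by
  rw [MetricGraph.value, C.along_eq_extend hN, C.extend_apply_apply]
  rfl

theorem outDeriv_eq_extend (hN : act.NoNeighbours) (f : R.IntertwiningMap act.smoothRep)
    (d : Γ.E × Bool) (r : W) :
    Γ.outDeriv (f r).1 d = C.extend (C.metricGraph.outDeriv (C.encode f).1) d r := by
  let F : Γ.E × Bool → W →ₗ[ℂ] ℂ := fun d =>
    { toFun := fun r => Γ.outDeriv (f r).1 d
      map_add' := fun r s => by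
        rw [map_add]
        exact congrFun (Γ.outDeriv_add (f r) (f s)) d
      map_smul' := fun c r => by
        rw [map_smul]
        exact congrFun (Γ.outDeriv_smul c (f r)) d }
  have h := C.eq_extend hN (F := F) fun g d r => outDeriv_onEnds f g d r
  exact LinearMap.congr_fun (congrFun h d) r

theorem encode_mem_smoothBC_iff (hN : act.NoNeighbours) (f : R.IntertwiningMap act.smoothRep) :
    C.encode f ∈ C.graph.SmoothBC ↔ ∀ r, f r ∈ Γ.SmoothBC := by
  refine (C.forall_boundaryCondition_graph_iff hN _ _).trans (forall_congr' fun r => ?_)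
  have h1 : (fun d => C.extend (C.metricGraph.value (C.encode f).1) d r) = Γ.value (f r).1 :=
    funext fun d => (C.value_eq_extend hN f d r).symm
  have h2 : (fun d => C.extend (C.metricGraph.outDeriv (C.encode f).1) d r) =
      Γ.outDeriv (f r).1 := funext fun d => (C.outDeriv_eq_extend hN f d r).symm
  refine forall_congr' fun y => ?_
  change Γ.BoundaryCondition y (fun d => C.extend (C.metricGraph.value (C.encode f).1) d r)
    (fun d => C.extend (C.metricGraph.outDeriv (C.encode f).1) d r) ↔ _
  rw [h1, h2]

theorem encode_injective (hN : act.NoNeighbours) : Function.Injective C.encode := by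
  intro f k h
  refine DFunLike.ext _ _ fun r => Subtype.ext (funext fun e => ?_)
  refine (C.along_eq_extend hN f (e, false) r).trans ?_
  rw [h]
  exact (C.along_eq_extend hN k (e, false) r).symm

/-- The equivariant map encoded by a smooth function on the quotient. -/
noncomputable def decode (hN : act.NoNeighbours) (φ : C.metricGraph.Smooth) :
    R.IntertwiningMap act.smoothRep :=
  LinearMap.intertwiningMap_of_isIntertwiningMap R act.smoothRep
    { toFun := fun r => ⟨fun e => C.extend (C.metricGraph.along φ.1) (e, false) r,
        C.extend_along_mem φ r⟩
      map_add' := fun r s => Subtype.ext (funext fun e => map_add _ r s)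
      map_smul' := fun c r => Subtype.ext (funext fun e => map_smul _ c r) } fun g r => by
    have h : ∀ d t, Γ.along (fun e => C.extend (C.metricGraph.along φ.1) (e, false) r) d t =
        C.extend (C.metricGraph.along φ.1) d r t := by
      rintro ⟨e, _ | _⟩ t
      · rfl
      · exact (C.extend_along_flip φ (e, false) r t).symm
    refine Subtype.ext (funext fun e => funext fun t => ?_)
    refine Eq.trans ?_ (h (act.onEnds g⁻¹ (e, false)) t).symm
    change C.extend (C.metricGraph.along φ.1) (e, false) (R g r) t = _
    conv_lhs => rw [← act.onEnds_onEnds_inv g (e, false)]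
    rw [C.extend_onEnds hN]

theorem encode_decode (hN : act.NoNeighbours) (φ : C.metricGraph.Smooth) :
    C.encode (C.decode hN φ) = φ :=
  Subtype.ext (funext fun p =>
    C.extend_basis hN (C.metricGraph.along φ.1) (p, false))

theorem encode_surjective (hN : act.NoNeighbours) : Function.Surjective C.encode := fun φ =>
  ⟨C.decode hN φ, C.encode_decode hN φ⟩

end

end Choices

/-- The Laplacian on smooth functions, as an equivariant map. -/
noncomputable def smoothLaplacianHom (act : Γ.Action G) :
    act.smoothRep.IntertwiningMap act.smoothRep :=
  Γ.laplacian.intertwiningMap_of_isIntertwiningMap act.smoothRep act.smoothRep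
    act.laplacian_smoothRep

/-- An equivariant map into `H(Γ)` as an equivariant map into the smooth functions. -/
noncomputable def toSmooth : act.Hom R →ₗ[ℂ] R.IntertwiningMap act.smoothRep where
  toFun f := (Γ.H.subtype ∘ₗ f.toLinearMap).intertwiningMap_of_isIntertwiningMap R act.smoothRep
    fun g r => congrArg Subtype.val (f.isIntertwining _ _ g r)
  map_add' _ _ := rfl
  map_smul' _ _ := rfl

theorem toSmooth_injective : Function.Injective (toSmooth (act := act) (R := R)) := by
  intro f k h
  ext r
  have h1 : toSmooth f r = toSmooth k r := congrArg (fun f => f r) h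
  exact congrFun (congrFun (congrArg Subtype.val h1) _) _

theorem mem_range_toSmooth {f : R.IntertwiningMap act.smoothRep} (hf : ∀ r, f r ∈ Γ.H) :
    ∃ k : act.Hom R, toSmooth k = f :=
  ⟨(f.toLinearMap.codRestrict Γ.H hf).intertwiningMap_of_isIntertwiningMap R act.repH
    fun g r => Subtype.ext (f.isIntertwining _ _ g r), rfl⟩

/-! ### Encoding respects eigenspaces and their spans -/

namespace Choices

variable [Finite G] (C : act.Choices R)

theorem encode_mem_Eig_iff (hN : act.NoNeighbours) (f : R.IntertwiningMap act.smoothRep) (μ : ℂ) :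
    C.encode f ∈ C.graph.Eig μ ↔ ∀ r, f r ∈ Γ.Eig μ := by
  have h1 : C.graph.laplacian (C.encode f) = C.encode (act.smoothLaplacianHom.comp f) :=
    C.laplacian_encode f _ fun _ => rfl
  have h2 : C.graph.laplacian (C.encode f) = μ • C.encode f ↔ ∀ r, Γ.laplacian (f r) = μ • f r := by
    refine (Eq.congr h1 (map_smul C.encode μ f).symm).trans
      ((C.encode_injective hN).eq_iff.trans ⟨fun h r => congrArg (fun f => f r) h, fun h => ?_⟩)
    exact DFunLike.ext _ _ h
  refine (mem_Eig_iff (Γ := C.graph)).trans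
    ((and_congr (C.encode_mem_smoothBC_iff hN f) h2).trans ?_)
  simp only [mem_Eig_iff, forall_and]

/-- An eigenfunction on the quotient decodes to an equivariant map into an eigenspace of `Γ`, which
gives one direction. Conversely each `f r` is a sum of eigenfunctions, and this decomposition must
be made equivariantly in `r` before it can be encoded. -/
theorem encode_mem_H_iff [FiniteDimensional ℂ W] (hN : act.NoNeighbours)
    (f : R.IntertwiningMap act.smoothRep) :
    C.encode f ∈ C.graph.H ↔ ∀ r, f r ∈ Γ.H := by
  constructor
  · intro h
    have hle : C.graph.H ≤ Submodule.map C.encode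
        { carrier := {k : R.IntertwiningMap act.smoothRep | ∀ r, k r ∈ Γ.H}
          add_mem' := fun ha hb r => Submodule.add_mem _ (ha r) (hb r)
          zero_mem' := fun r => Submodule.zero_mem _
          smul_mem' := fun c _ ha r => Submodule.smul_mem _ c (ha r) } := by
      refine iSup_le fun μ φ hφ => ?_
      obtain ⟨k, rfl⟩ := C.encode_surjective hN φ
      exact ⟨k, fun r => le_iSup Γ.Eig μ ((C.encode_mem_Eig_iff hN k μ).1 hφ r), rfl⟩
    obtain ⟨k, hk, hkf⟩ := hle h
    rw [← C.encode_injective hN hkf]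
    exact hk
  · intro h
    -- Finite dimension of `R` gives one finite set of eigenvalues for all `r`.
    obtain ⟨s, hs⟩ := Submodule.exists_finset_forall_mem_iSup Γ.Eig f.toLinearMap h
    have hE : ∀ μ, Γ.Eig μ ≤ Module.End.eigenspace Γ.laplacian μ := fun μ => inf_le_right
    have hp := fun r => Module.End.aeval_lagrange_basis_apply Γ.laplacian Γ.Eig hE s (hs r)
    have hcomm : ∀ (p : ℂ[X]) (g : G) (k : Γ.Smooth), Polynomial.aeval Γ.laplacian p
        (act.smoothRep g k) = act.smoothRep g (Polynomial.aeval Γ.laplacian p k) := by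
      intro p g k
      have h1 : Commute Γ.laplacian (act.smoothRep g) :=
        LinearMap.ext fun k => act.laplacian_smoothRep g k
      have h2 : Commute (Polynomial.aeval Γ.laplacian p) (act.smoothRep g) := by
        induction p using Polynomial.induction_on' with
        | add p q hp hq =>
          rw [map_add]
          exact hp.add_left hq
        | monomial n c =>
          rw [Polynomial.aeval_monomial]
          exact (Algebra.commute_algebraMap_left c _).mul_left (h1.pow_left n)
      exact LinearMap.congr_fun h2.eq k
    -- The component of `f` for the eigenvalue `μ`; it is equivariant since polynomials in the
    -- Laplacian commute with `G`.
    let k : ℂ → R.IntertwiningMap act.smoothRep := fun μ =>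
      (Polynomial.aeval Γ.laplacian (Lagrange.basis s id μ) ∘ₗ
        f.toLinearMap).intertwiningMap_of_isIntertwiningMap R act.smoothRep fun g r => by
          change Polynomial.aeval Γ.laplacian _ (f (R g r)) = _
          rw [f.isIntertwining, hcomm]
          rfl
    have hk : f = ∑ μ ∈ s, k μ := by
      refine DFunLike.ext _ _ fun r => ?_
      rw [Representation.IntertwiningMap.sum_apply]
      exact (hp r).2.symm
    rw [hk, map_sum]
    refine Submodule.sum_mem _ fun μ hμ => le_iSup C.graph.Eig μ ?_
    exact (C.encode_mem_Eig_iff hN (k μ) μ).2 fun r => (hp r).1 μ hμ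

theorem exists_isEncoding [FiniteDimensional ℂ W] (hN : act.NoNeighbours) :
    ∃ Ψ : Module.AEval' (act.homLaplacian R) ≃ₗ[ℂ[X]] Module.AEval' C.graph.laplacianH,
      C.IsEncoding Ψ := by
  have hmem : ∀ f : act.Hom R, C.encode (toSmooth f) ∈ C.graph.H := fun f =>
    (C.encode_mem_H_iff hN _).2 fun r => (f r).2
  let φ : act.Hom R →ₗ[ℂ] C.graph.H := (C.encode ∘ₗ toSmooth).codRestrict C.graph.H hmem
  have hφ : Function.Bijective φ := by
    refine ⟨fun f k h => ?_, fun ψ => ?_⟩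
    · exact toSmooth_injective (C.encode_injective hN (congrArg Subtype.val h))
    · obtain ⟨f, hf⟩ := C.encode_surjective hN ψ.1
      obtain ⟨k, rfl⟩ := mem_range_toSmooth
        ((C.encode_mem_H_iff hN f).1 (by rw [hf]; exact ψ.2))
      exact ⟨k, Subtype.ext hf⟩
  obtain ⟨Ψ, hΨ⟩ := Module.AEval'.exists_equiv (act.homLaplacian R) C.graph.laplacianH
    (LinearEquiv.ofBijective φ hφ) fun f => Subtype.ext
      (C.laplacian_encode (toSmooth f) (toSmooth (act.homLaplacian R f)) fun _ => rfl).symm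
  refine ⟨Ψ, fun f p t => ?_⟩
  rw [hΨ]
  rfl

end Choices

end Action

end QuantumGraph

/-! ### The barycentric subdivision -/

namespace MetricGraph

variable (Γ : MetricGraph.{u})

/-- The barycentric subdivision: each edge is cut at its midpoint. The edges are the edge ends of
`Γ`, with the distance from that end as coordinate. -/
noncomputable def subdivision : MetricGraph.{u} where
  V := Γ.V ⊕ Γ.E
  E := Γ.E × Bool
  finite_V := by
    have := Γ.finite_V
    have := Γ.finite_E
    infer_instance
  finite_E := by
    have := Γ.finite_E
    infer_instance
  endpt d := if d.2 then Sum.inr d.1.1 else Sum.inl (Γ.endpt d.1)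
  len d := Γ.len d.1 / 2
  len_pos d := half_pos (Γ.len_pos d.1)

/-- A vertex of `Γ` as a vertex of the subdivision. -/
def oldVertex (x : Γ.V) : Γ.subdivision.V := Sum.inl x

/-- The midpoint of an edge as a vertex of the subdivision. -/
def midpoint (e : Γ.E) : Γ.subdivision.V := Sum.inr e

theorem subdivision_endpt_eq_oldVertex {c : (Γ.E × Bool) × Bool} {x : Γ.V} :
    Γ.subdivision.endpt c = Γ.oldVertex x ↔ c.2 = false ∧ Γ.endpt c.1 = x := by
  rcases c with ⟨d, _ | _⟩ <;> simp [subdivision, oldVertex]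

theorem subdivision_endpt_eq_midpoint {c : (Γ.E × Bool) × Bool} {e : Γ.E} :
    Γ.subdivision.endpt c = Γ.midpoint e ↔ c.2 = true ∧ c.1.1 = e := by
  rcases c with ⟨d, _ | _⟩ <;> simp [subdivision, midpoint]

/-- The ends at an old vertex of the subdivision. -/
noncomputable def endsAtOldVertex (x : Γ.V) : Γ.EndsAt x ≃ Γ.subdivision.EndsAt (Γ.oldVertex x) where
  toFun d := ⟨(d.1, false), Γ.subdivision_endpt_eq_oldVertex.2 ⟨rfl, d.2⟩⟩
  invFun c := ⟨c.1.1, (Γ.subdivision_endpt_eq_oldVertex.1 c.2).2⟩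
  left_inv _ := rfl
  right_inv c := Subtype.ext (Prod.ext rfl (Γ.subdivision_endpt_eq_oldVertex.1 c.2).1.symm)

/-- The ends at a midpoint in the subdivision. -/
noncomputable def endsAtMidpoint (e : Γ.E) : Bool ≃ Γ.subdivision.EndsAt (Γ.midpoint e) where
  toFun b := ⟨((e, b), true), Γ.subdivision_endpt_eq_midpoint.2 ⟨rfl, rfl⟩⟩
  invFun c := c.1.1.2
  left_inv _ := rfl
  right_inv c := Subtype.ext (Prod.ext
    (Prod.ext (Γ.subdivision_endpt_eq_midpoint.1 c.2).2.symm rfl)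
    (Γ.subdivision_endpt_eq_midpoint.1 c.2).1.symm)

variable {Γ} in
-- The midpoint at one end of a half-edge determines the original edge, and without loops the old
-- vertex determines which half it is. Parallel edges are separated by their midpoints.
theorem isSimple_subdivision (hΓ : ∀ e, Γ.endpt (e, false) ≠ Γ.endpt (e, true)) :
    Γ.subdivision.IsSimple := by
  refine ⟨fun d => by simp [subdivision], ?_⟩
  rintro ⟨e, b⟩ ⟨e', b'⟩ h
  have h' : s(Sum.inl (Γ.endpt (e, b)), Sum.inr e) = s(Sum.inl (Γ.endpt (e', b')), Sum.inr e') := h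
  simp only [Sym2.eq_iff, Sum.inl.injEq, Sum.inr.injEq, reduceCtorEq, and_self, or_false] at h'
  obtain ⟨h1, rfl⟩ := h'
  refine Prod.ext rfl ?_
  rcases b with _ | _ <;> rcases b' with _ | _
  · rfl
  · exact absurd h1 (hΓ e)
  · exact absurd h1.symm (hΓ e)
  · rfl

theorem subdivision_seg_subset (d : Γ.E × Bool) : Γ.subdivision.seg d ⊆ Γ.seg d.1 :=
  Icc_subset_Icc le_rfl (half_le_self (Γ.len_pos d.1).le)

/-- The restriction of functions on `Γ` to the edges of the subdivision. -/
noncomputable def subdivide : Γ.Smooth →ₗ[ℂ] Γ.subdivision.Smooth where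
  toFun f := ⟨fun d => (Γ.subdivision.seg d).indicator (Γ.along f.1 d), fun d =>
    ⟨((Γ.contDiffOn_along f d).mono (Γ.subdivision_seg_subset d)).congr fun _ ht =>
      indicator_of_mem ht _, fun _ ht => indicator_of_notMem ht _⟩⟩
  map_add' _ _ := Subtype.ext (funext fun _ => indicator_add _ _ _)
  map_smul' c _ := Subtype.ext (funext fun _ => indicator_const_smul _ c _)

theorem subdivide_apply (f : Γ.Smooth) {d : Γ.E × Bool} {t : ℝ} (ht : t ∈ Γ.subdivision.seg d) :
    (Γ.subdivide f).1 d t = Γ.along f.1 d t := indicator_of_mem ht _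

theorem derivWithin_subdivide (f : Γ.Smooth) {d : Γ.E × Bool} {t : ℝ}
    (ht : t ∈ Γ.subdivision.seg d) :
    derivWithin ((Γ.subdivide f).1 d) (Γ.subdivision.seg d) t =
      derivWithin (Γ.along f.1 d) (Γ.seg d.1) t := by
  rw [derivWithin_congr (fun t ht => Γ.subdivide_apply f ht) (Γ.subdivide_apply f ht)]
  exact derivWithin_subset (Γ.subdivision_seg_subset d) (Γ.subdivision.uniqueDiffOn_seg d t ht)
    (Γ.differentiableWithinAt_along f d (Γ.subdivision_seg_subset d ht))

theorem subdivide_injective : Function.Injective Γ.subdivide := by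
  rw [← LinearMap.ker_eq_bot, LinearMap.ker_eq_bot']
  intro f hf
  have h : ∀ d, ∀ t ∈ Γ.subdivision.seg d, Γ.along f.1 d t = 0 := by
    intro d t ht
    rw [← Γ.subdivide_apply f ht, hf]
    rfl
  refine Subtype.ext (funext fun e => funext fun t => ?_)
  by_cases ht : t ∈ Γ.seg e
  · rcases le_total t (Γ.len e / 2) with h1 | h1
    · exact h (e, false) t ⟨ht.1, h1⟩
    · have h2 := h (e, true) (Γ.len e - t) ⟨by linarith [ht.2], by
        change _ ≤ Γ.len e / 2
        linarith⟩
      simpa [along, coord] using h2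
  · exact (f.2 e).2 t ht

theorem value_subdivide_false (f : Γ.Smooth) (d : Γ.E × Bool) :
    Γ.subdivision.value (Γ.subdivide f).1 (d, false) = Γ.value f.1 d := by
  exact (Γ.subdivision.value_false _ d).trans
    (Γ.subdivide_apply f (Γ.subdivision.zero_mem_seg d))

theorem outDeriv_subdivide_false (f : Γ.Smooth) (d : Γ.E × Bool) :
    Γ.subdivision.outDeriv (Γ.subdivide f).1 (d, false) = Γ.outDeriv f.1 d := by
  exact (Γ.subdivision.outDeriv_false _ d).trans
    (Γ.derivWithin_subdivide f (Γ.subdivision.zero_mem_seg d))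

theorem coord_half (d : Γ.E × Bool) : Γ.coord d (Γ.len d.1 / 2) = Γ.len d.1 / 2 := by
  rw [coord]
  split_ifs <;> ring

theorem value_subdivide_true (f : Γ.Smooth) (d : Γ.E × Bool) :
    Γ.subdivision.value (Γ.subdivide f).1 (d, true) = f.1 d.1 (Γ.len d.1 / 2) := by
  exact ((Γ.subdivision.value_true _ d).trans
    (Γ.subdivide_apply f (Γ.subdivision.len_mem_seg d))).trans
    (congrArg (f.1 d.1) (Γ.coord_half d))

theorem outDeriv_subdivide_true (f : Γ.Smooth) (d : Γ.E × Bool) :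
    Γ.subdivision.outDeriv (Γ.subdivide f).1 (d, true) =
      -((if d.2 then -1 else 1 : ℂ) * derivWithin (f.1 d.1) (Γ.seg d.1) (Γ.len d.1 / 2)) := by
  refine (Γ.subdivision.outDeriv_true _ d).trans ?_
  rw [Γ.derivWithin_subdivide f (Γ.subdivision.len_mem_seg d), derivWithin_along]
  exact congrArg (fun t => -(_ * derivWithin (f.1 d.1) (Γ.seg d.1) t)) (Γ.coord_half d)

/-! ### Eigenfunctions as solutions of differential equations -/

/-- Measured from the far end, the first derivative changes sign, but the equation has only a second
derivative. -/
theorem isSolutionOn_along {f : Γ.Smooth} {μ : ℂ} (h : Γ.laplacian f = μ • f) (d : Γ.E × Bool) :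
    IsSolutionOn μ (Γ.seg d.1) (Γ.along f.1 d) (derivWithin (Γ.along f.1 d) (Γ.seg d.1)) := by
  intro t ht
  refine ⟨(Γ.differentiableWithinAt_along f d ht).hasDerivWithinAt, ?_⟩
  have h1 : DifferentiableWithinAt ℝ (derivWithin (Γ.along f.1 d) (Γ.seg d.1)) (Γ.seg d.1) t :=
    (contDiffOn_derivWithin (Γ.uniqueDiffOn_seg d.1) (Γ.contDiffOn_along f d)).differentiableOn
      (by simp) t ht
  refine h1.hasDerivWithinAt.congr_deriv ?_
  have ht' : Γ.coord d t ∈ Γ.seg d.1 := (Γ.coord_mem_seg d t).2 ht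
  have h2 : derivWithin (Γ.along f.1 d) (Γ.seg d.1) = fun s => (if d.2 then -1 else 1 : ℂ) *
      Γ.along (fun e => derivWithin (f.1 e) (Γ.seg e)) d s :=
    funext fun s => Γ.derivWithin_along f.1 d s
  have h3 : -Γ.secondDeriv f.1 d.1 (Γ.coord d t) = μ * f.1 d.1 (Γ.coord d t) := by
    rw [← Γ.laplacian_apply f ht', h]
    rfl
  rw [h2, derivWithin_const_mul_field, derivWithin_along, ← mul_assoc]
  change _ * Γ.secondDeriv f.1 d.1 (Γ.coord d t) = -(μ * f.1 d.1 (Γ.coord d t))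
  rw [← h3]
  split_ifs <;> simp

theorem laplacian_eq_smul {f : Γ.Smooth} {μ : ℂ} (h : ∀ e, ∃ k k' : ℝ → ℂ,
    IsSolutionOn μ (Γ.seg e) k k' ∧ ∀ t ∈ Γ.seg e, f.1 e t = k t) : Γ.laplacian f = μ • f := by
  refine Subtype.ext (funext fun e => funext fun t => ?_)
  change _ = μ * f.1 e t
  by_cases ht : t ∈ Γ.seg e
  · obtain ⟨k, k', hk, hfk⟩ := h e
    have h1 : ∀ t ∈ Γ.seg e, derivWithin (f.1 e) (Γ.seg e) t = k' t := fun t ht => by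
      rw [derivWithin_congr hfk (hfk t ht)]
      exact (hk t ht).1.derivWithin (Γ.uniqueDiffOn_seg e t ht)
    rw [Γ.laplacian_apply f ht, secondDeriv, derivWithin_congr h1 (h1 t ht),
      (hk t ht).2.derivWithin (Γ.uniqueDiffOn_seg e t ht), hfk t ht, neg_neg]
  · rw [(f.2 e).2 t ht, (((Γ.laplacian f).2 e).2 t ht), mul_zero]

theorem laplacian_subdivide {f : Γ.Smooth} {μ : ℂ} (h : Γ.laplacian f = μ • f) :
    Γ.subdivision.laplacian (Γ.subdivide f) = μ • Γ.subdivide f :=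
  Γ.subdivision.laplacian_eq_smul fun d => ⟨_, _,
    (Γ.isSolutionOn_along h d).mono (Γ.subdivision_seg_subset d),
    fun _ ht => Γ.subdivide_apply f ht⟩

/-- Matching values and first derivatives do not make a function smooth at the midpoint in general.
For eigenfunctions they do: the solution on one half continues along the whole edge, and on the
other half it agrees with the given one by uniqueness. -/
theorem exists_subdivide_eq {g : Γ.subdivision.Smooth} {μ : ℂ}
    (hg : Γ.subdivision.laplacian g = μ • g)
    (hval : ∀ e, Γ.subdivision.value g.1 ((e, true), true) =
      Γ.subdivision.value g.1 ((e, false), true))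
    (hder : ∀ e, Γ.subdivision.outDeriv g.1 ((e, true), true) +
      Γ.subdivision.outDeriv g.1 ((e, false), true) = 0) :
    ∃ f : Γ.Smooth, Γ.laplacian f = μ • f ∧ Γ.subdivide f = g := by
  obtain ⟨c, s, hc, hs, hc', hs', hc0, hs0, -⟩ := exists_fundamental_system μ
  let α : Γ.E → ℂ := fun e => g.1 (e, false) 0
  let β : Γ.E → ℂ := fun e => derivWithin (g.1 (e, false)) (Γ.subdivision.seg (e, false)) 0
  -- The solution on the whole line with the Cauchy data of `g` at the end `(e, false)`.
  let φ : Γ.E → ℝ → ℂ := fun e t => α e * c t + β e * s t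
  let φ' : Γ.E → ℝ → ℂ := fun e t => α e * -(μ * s t) + β e * c t
  have hφ : ∀ e, ContDiff ℝ ∞ (φ e) := fun e =>
    (contDiff_const.mul hc).add (contDiff_const.mul hs)
  have hsol : ∀ e S, IsSolutionOn μ S (φ e) (φ' e) := fun e S =>
    IsSolutionOn.linearCombination hc' hs' (α e) (β e) S
  have hg' : ∀ d, IsSolutionOn μ (Γ.subdivision.seg d) (g.1 d)
      (derivWithin (g.1 d) (Γ.subdivision.seg d)) := fun d =>
    Γ.subdivision.isSolutionOn_along hg (d, false)
  have hfalse : ∀ e, ∀ t ∈ Γ.subdivision.seg (e, false), g.1 (e, false) t = φ e t := fun e =>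
    (hg' (e, false)).eqOn (hsol e _) (Γ.subdivision.zero_mem_seg _) (by simp [φ, α, hc0, hs0])
      (by simp [φ', β, hc0, hs0])
  have hfalse' : ∀ e, derivWithin (g.1 (e, false)) (Γ.subdivision.seg (e, false))
      (Γ.len e / 2) = φ' e (Γ.len e / 2) := fun e => by
    have hm := Γ.subdivision.len_mem_seg (e, false)
    refine (derivWithin_congr (hfalse e) (hfalse e _ hm)).trans ?_
    exact (hsol e _ _ hm).1.derivWithin (Γ.subdivision.uniqueDiffOn_seg _ _ hm)
  refine ⟨Γ.ofFamily φ hφ, Γ.laplacian_eq_smul fun e =>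
    ⟨_, _, hsol e _, fun t ht => Γ.ofFamily_apply hφ ht⟩, ?_⟩
  refine Subtype.ext (funext fun d => funext fun t => ?_)
  by_cases ht : t ∈ Γ.subdivision.seg d
  · rw [Γ.subdivide_apply _ ht]
    rcases d with ⟨e, _ | _⟩
    · refine Eq.trans ?_ (hfalse e t ht).symm
      exact Γ.ofFamily_apply hφ (Γ.subdivision_seg_subset (e, false) ht)
    -- The other half is measured from the far end, so `φ` is reflected; the Cauchy data are
    -- compared at the midpoint, the right end of the segment.
    · have hrev : IsSolutionOn μ (Γ.subdivision.seg (e, true)) (fun t => φ e (Γ.len e - t))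
          (fun t => -φ' e (Γ.len e - t)) :=
        ((hsol e univ).comp_const_sub (Γ.len e) fun _ _ => mem_univ _).mono (subset_univ _)
      have hhalf : Γ.len e - Γ.len e / 2 = Γ.len e / 2 := by ring
      have hm := Γ.subdivision.len_mem_seg (e, true)
      have hv : g.1 (e, true) (Γ.len e / 2) = φ e (Γ.len e - Γ.len e / 2) := by
        have h := (Γ.subdivision.value_true g.1 (e, true)).symm.trans
          ((hval e).trans (Γ.subdivision.value_true g.1 (e, false)))
        rw [hhalf]
        exact h.trans (hfalse e _ (Γ.subdivision.len_mem_seg (e, false)))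
      have hd : derivWithin (g.1 (e, true)) (Γ.subdivision.seg (e, true)) (Γ.len e / 2) =
          -φ' e (Γ.len e - Γ.len e / 2) := by
        have h2 : -derivWithin (g.1 (e, true)) (Γ.subdivision.seg (e, true)) (Γ.len e / 2) +
            -derivWithin (g.1 (e, false)) (Γ.subdivision.seg (e, false)) (Γ.len e / 2) = 0 :=
          (congrArg₂ (· + ·) (Γ.subdivision.outDeriv_true g.1 (e, true))
            (Γ.subdivision.outDeriv_true g.1 (e, false))).symm.trans (hder e)
        rw [hfalse'] at h2
        rw [hhalf]
        linear_combination -h2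
      refine Eq.trans ?_ ((hg' (e, true)).eqOn hrev hm hv hd t ht).symm
      exact Γ.ofFamily_apply hφ ((Γ.coord_mem_seg (e, true) t).2
        (Γ.subdivision_seg_subset (e, true) ht))
  · rw [(g.2 d).2 t ht, ((Γ.subdivide _).2 d).2 t ht]

end MetricGraph

/-! ### Subdivision of quantum graphs -/

namespace QuantumGraph

variable (Γ : QuantumGraph.{u})

/-- The barycentric subdivision of a quantum graph: at the midpoints of edges functions are
continuous and their outgoing derivatives sum to zero. -/
noncomputable def subdivision : QuantumGraph.{u} where
  toMetricGraph := Γ.toMetricGraph.subdivision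
  Row := Sum.elim Γ.Row fun _ => Bool
  finite_Row x := by
    rcases x with x | e
    · exact Γ.finite_Row x
    · exact inferInstanceAs (Finite Bool)
  A x := match x with
    | Sum.inl x => Matrix.of fun k c => Γ.A x k ((Γ.endsAtOldVertex x).symm c)
    -- The row `false` expresses continuity, the row `true` the vanishing of the sum of the
    -- derivatives.
    | Sum.inr e => Matrix.of fun k c =>
      bif k then 0 else bif (Γ.endsAtMidpoint e).symm c then 1 else -1
  B x := match x with
    | Sum.inl x => Matrix.of fun k c => Γ.B x k ((Γ.endsAtOldVertex x).symm c)
    | Sum.inr _ => Matrix.of fun k _ => bif k then 1 else 0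

theorem boundaryCondition_oldVertex (x : Γ.V) (a b : (Γ.E × Bool) × Bool → ℂ) :
    Γ.subdivision.BoundaryCondition (Γ.oldVertex x) a b ↔
      Γ.BoundaryCondition x (fun d => a (d, false)) (fun d => b (d, false)) := by
  have key : ∀ (X : Matrix (Γ.Row x) (Γ.EndsAt x) ℂ) (u : (Γ.E × Bool) × Bool → ℂ) k,
      ∑ c : Γ.toMetricGraph.subdivision.EndsAt (Γ.oldVertex x),
        X k ((Γ.endsAtOldVertex x).symm c) * u c.1 = ∑ d : Γ.EndsAt x, X k d * u (d.1, false) := by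
    intro X u k
    rw [← (Γ.endsAtOldVertex x).sum_comp]
    rfl
  refine (Γ.subdivision.boundaryCondition_iff_sum _ _ _).trans
    (Iff.trans ?_ (Γ.boundaryCondition_iff_sum _ _ _).symm)
  refine forall_congr' fun k => ?_
  have h1 := key (Γ.A x) a k
  have h2 := key (Γ.B x) b k
  exact Iff.of_eq (congrArg (· = 0) (congrArg₂ (· + ·) h1 h2))

theorem boundaryCondition_midpoint (e : Γ.E) (a b : (Γ.E × Bool) × Bool → ℂ) :
    Γ.subdivision.BoundaryCondition (Γ.midpoint e) a b ↔
      a ((e, true), true) = a ((e, false), true) ∧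
        b ((e, true), true) + b ((e, false), true) = 0 := by
  have key : ∀ (X : Bool → ℂ) (u : (Γ.E × Bool) × Bool → ℂ),
      ∑ c : Γ.toMetricGraph.subdivision.EndsAt (Γ.midpoint e), X ((Γ.endsAtMidpoint e).symm c) * u c.1 =
        X true * u ((e, true), true) + X false * u ((e, false), true) := by
    intro X u
    rw [← (Γ.endsAtMidpoint e).sum_comp, Fintype.sum_bool]
    rfl
  have h := Γ.subdivision.boundaryCondition_iff_sum (Γ.midpoint e) a b
  have h' : Γ.subdivision.BoundaryCondition (Γ.midpoint e) a b ↔ ∀ k : Bool,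
      ∑ c : Γ.toMetricGraph.subdivision.EndsAt (Γ.midpoint e),
        (fun i => bif k then (0 : ℂ) else bif i then 1 else -1) ((Γ.endsAtMidpoint e).symm c) * a c.1 +
      ∑ c : Γ.toMetricGraph.subdivision.EndsAt (Γ.midpoint e),
        (fun _ => bif k then (1 : ℂ) else 0) ((Γ.endsAtMidpoint e).symm c) * b c.1 = 0 := h
  have h'' : Γ.subdivision.BoundaryCondition (Γ.midpoint e) a b ↔ ∀ k : Bool,
      ((bif k then (0 : ℂ) else 1) * a ((e, true), true) +
        (bif k then (0 : ℂ) else -1) * a ((e, false), true)) +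
      ((bif k then (1 : ℂ) else 0) * b ((e, true), true) +
        (bif k then (1 : ℂ) else 0) * b ((e, false), true)) = 0 :=
    h'.trans (forall_congr' fun k =>
      Iff.of_eq (congrArg (· = 0) (congrArg₂ (· + ·) (key (fun i => bif k then 0 else bif i then 1 else -1) a)
        (key (fun _ => bif k then 1 else 0) b))))
  refine h''.trans (Bool.forall_bool.trans ?_)
  simp only [cond_true, cond_false, one_mul, zero_mul, neg_mul, add_zero, zero_add,
    ← sub_eq_add_neg, sub_eq_zero]

/-- At a midpoint the conditions say that the values are symmetric and the derivatives antisymmetric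
under exchange of the halves; the rotated space has these parities interchanged. The splitting is
into even and odd parts. -/
theorem isSplit_subdivision (h : Γ.IsSplit) : Γ.subdivision.IsSplit := by
  suffices h : (∀ a b : (Γ.E × Bool) × Bool → ℂ, (∀ x, Γ.subdivision.BoundaryCondition x a b) →
      (∀ x, Γ.subdivision.BoundaryCondition x b (-a)) → a = 0 ∧ b = 0) ∧
      ∀ a b : (Γ.E × Bool) × Bool → ℂ, ∃ p q p' q' : (Γ.E × Bool) × Bool → ℂ,
        (∀ x, Γ.subdivision.BoundaryCondition x p q) ∧
        (∀ x, Γ.subdivision.BoundaryCondition x p' q') ∧ a = p - q' ∧ b = q + p' from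
    Γ.subdivision.isSplit_iff.2 h
  have hiff : ∀ a b : (Γ.E × Bool) × Bool → ℂ, (∀ x, Γ.subdivision.BoundaryCondition x a b) ↔
      (∀ x, Γ.BoundaryCondition x (fun d => a (d, false)) (fun d => b (d, false))) ∧
      ∀ e, a ((e, true), true) = a ((e, false), true) ∧
        b ((e, true), true) + b ((e, false), true) = 0 := by
    intro a b
    refine Sum.forall.trans (and_congr ?_ ?_)
    · exact forall_congr' fun x => Γ.boundaryCondition_oldVertex x a b
    · exact forall_congr' fun e => Γ.boundaryCondition_midpoint e a b
  obtain ⟨h1, h2⟩ := Γ.isSplit_iff.1 h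
  simp only [hiff]
  refine ⟨fun a b hab hba => ?_, fun a b => ?_⟩
  · obtain ⟨h3, h4⟩ := h1 _ _ hab.1 hba.1
    have h5 : ∀ e, a ((e, true), true) = 0 ∧ a ((e, false), true) = 0 ∧
        b ((e, true), true) = 0 ∧ b ((e, false), true) = 0 := by
      intro e
      obtain ⟨e1, e2⟩ := hab.2 e
      obtain ⟨e3, e4⟩ := hba.2 e
      simp only [Pi.neg_apply] at e4
      refine ⟨?_, ?_, ?_, ?_⟩
      · linear_combination (1 / 2 : ℂ) * e1 - (1 / 2 : ℂ) * e4
      · linear_combination -(1 / 2 : ℂ) * e1 - (1 / 2 : ℂ) * e4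
      · linear_combination (1 / 2 : ℂ) * e3 + (1 / 2 : ℂ) * e2
      · linear_combination -(1 / 2 : ℂ) * e3 + (1 / 2 : ℂ) * e2
    refine ⟨funext ?_, funext ?_⟩
    · rintro ⟨⟨e, _ | _⟩, _ | _⟩
      exacts [congrFun h3 (e, false), (h5 e).2.1, congrFun h3 (e, true), (h5 e).1]
    · rintro ⟨⟨e, _ | _⟩, _ | _⟩
      exacts [congrFun h4 (e, false), (h5 e).2.2.2, congrFun h4 (e, true), (h5 e).2.2.1]
  · obtain ⟨p, q, p', q', h3, h4, h5, h6⟩ := h2 (fun d => a (d, false)) (fun d => b (d, false))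
    -- At midpoints `p` and `p'` are the even parts of `a` and `b`, while `q` is the odd part of `b`
    -- and `q'` minus the odd part of `a`.
    refine ⟨
      fun c => bif c.2 then (a ((c.1.1, true), true) + a ((c.1.1, false), true)) / 2 else p c.1,
      fun c => bif c.2 then (b (c.1, true) - b (MetricGraph.flip c.1, true)) / 2 else q c.1,
      fun c => bif c.2 then (b ((c.1.1, true), true) + b ((c.1.1, false), true)) / 2 else p' c.1,
      fun c => bif c.2 then (a (MetricGraph.flip c.1, true) - a (c.1, true)) / 2 else q' c.1,
      ⟨h3, fun e => ⟨rfl, ?_⟩⟩, ⟨h4, fun e => ⟨rfl, ?_⟩⟩, funext ?_, funext ?_⟩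
    · simp only [MetricGraph.flip, cond_true, Bool.not_true, Bool.not_false]
      ring
    · simp only [MetricGraph.flip, cond_true, Bool.not_true, Bool.not_false]
      ring
    · rintro ⟨⟨e, _ | _⟩, _ | _⟩
      · exact congrFun h5 (e, false)
      · simp only [MetricGraph.flip, cond_true, Bool.not_false, Pi.sub_apply]
        ring
      · exact congrFun h5 (e, true)
      · simp only [MetricGraph.flip, cond_true, Bool.not_true, Pi.sub_apply]
        ring
    · rintro ⟨⟨e, _ | _⟩, _ | _⟩
      · exact congrFun h6 (e, false)
      · simp only [MetricGraph.flip, cond_true, Bool.not_false, Pi.add_apply]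
        ring
      · exact congrFun h6 (e, true)
      · simp only [MetricGraph.flip, cond_true, Bool.not_true, Pi.add_apply]
        ring

theorem subdivide_mem_smoothBC_iff (f : Γ.Smooth) :
    Γ.subdivide f ∈ Γ.subdivision.SmoothBC ↔ f ∈ Γ.SmoothBC := by
  have hinl : ∀ x, Γ.subdivision.BoundaryCondition (Γ.oldVertex x)
      (Γ.toMetricGraph.subdivision.value (Γ.subdivide f).1)
      (Γ.toMetricGraph.subdivision.outDeriv (Γ.subdivide f).1) ↔
      Γ.BoundaryCondition x (Γ.value f.1) (Γ.outDeriv f.1) := by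
    intro x
    refine (Γ.boundaryCondition_oldVertex x _ _).trans ?_
    exact Iff.of_eq (congrArg₂ (Γ.BoundaryCondition x)
      (funext fun d => Γ.value_subdivide_false f d) (funext fun d => Γ.outDeriv_subdivide_false f d))
  have hinr : ∀ e, Γ.subdivision.BoundaryCondition (Γ.midpoint e)
      (Γ.toMetricGraph.subdivision.value (Γ.subdivide f).1)
      (Γ.toMetricGraph.subdivision.outDeriv (Γ.subdivide f).1) := by
    intro e
    refine (Γ.boundaryCondition_midpoint e _ _).2
      ⟨(Γ.value_subdivide_true f (e, true)).trans (Γ.value_subdivide_true f (e, false)).symm,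
        (congrArg₂ (· + ·) (Γ.outDeriv_subdivide_true f (e, true))
          (Γ.outDeriv_subdivide_true f (e, false))).trans ?_⟩
    simp
  exact ⟨fun h x => (hinl x).1 (h (Γ.oldVertex x)), fun h => Sum.rec (fun x => (hinl x).2 (h x)) hinr⟩

theorem map_Eig_subdivide (μ : ℂ) :
    (Γ.Eig μ).map Γ.subdivide = Γ.subdivision.Eig μ := by
  refine le_antisymm ?_ fun g hg => ?_
  · rintro _ ⟨f, hf, rfl⟩
    obtain ⟨h1, h2⟩ := mem_Eig_iff.1 hf
    exact mem_Eig_iff.2 ⟨(Γ.subdivide_mem_smoothBC_iff f).2 h1, Γ.laplacian_subdivide h2⟩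
  · obtain ⟨h1, h2⟩ := mem_Eig_iff.1 hg
    have h3 := fun e => (Γ.boundaryCondition_midpoint e _ _).1 (h1 (Γ.midpoint e))
    obtain ⟨f, hf, rfl⟩ := Γ.exists_subdivide_eq h2 (fun e => (h3 e).1) fun e => (h3 e).2
    exact ⟨f, mem_Eig_iff.2 ⟨(Γ.subdivide_mem_smoothBC_iff f).1 h1, hf⟩, rfl⟩

theorem map_H_subdivide : Γ.H.map Γ.subdivide = Γ.subdivision.H := by
  rw [H, Submodule.map_iSup]
  exact iSup_congr Γ.map_Eig_subdivide

/-- Subdivision does not change `H(Γ)`. -/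
noncomputable def subdivideH : Γ.H ≃ₗ[ℂ] Γ.subdivision.H :=
  (Γ.H.equivMapOfInjective Γ.subdivide Γ.subdivide_injective).trans
    (LinearEquiv.ofEq _ _ Γ.map_H_subdivide)

/-- Both sides are linear, so it suffices to compare them on eigenfunctions, which span `H(Γ)`. -/
theorem subdivideH_laplacianH (f : Γ.H) :
    Γ.subdivideH (Γ.laplacianH f) = Γ.subdivision.laplacianH (Γ.subdivideH f) := by
  have h : Γ.H ≤ LinearMap.eqLocus (Γ.subdivide ∘ₗ Γ.laplacian)
      (Γ.toMetricGraph.subdivision.laplacian ∘ₗ Γ.subdivide) := by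
    refine iSup_le fun μ f hf => ?_
    have h2 := (mem_Eig_iff.1 hf).2
    change Γ.subdivide (Γ.laplacian f) =
      Γ.toMetricGraph.subdivision.laplacian (Γ.subdivide f)
    rw [Γ.laplacian_subdivide h2, h2, map_smul]
  exact Subtype.ext (h f.2)

/-! ### The group action on the subdivision -/

namespace Action

variable {Γ} {G : Type v} [Group G] (act : Γ.Action G)

/-- The action on the barycentric subdivision. -/
noncomputable def subdivision : Γ.subdivision.Action G where
  onV :=
    { toFun := fun g =>
        { toFun := Sum.map (act.onV g) (act.onE g)
          invFun := Sum.map (act.onV g⁻¹) (act.onE g⁻¹)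
          left_inv := by
            rintro (x | e)
            · exact congrArg Sum.inl (by simp)
            · exact congrArg Sum.inr (act.onE_inv_of_eq rfl)
          right_inv := by
            rintro (x | e)
            · exact congrArg Sum.inl (by simp)
            · refine congrArg Sum.inr ?_
              rw [← act.onE_mul, mul_inv_cancel, act.onE_one] }
      map_one' := by
        refine Equiv.ext ?_
        rintro (x | e)
        · exact congrArg Sum.inl (by simp)
        · exact congrArg Sum.inr (act.onE_one e)
      map_mul' := fun g h => by
        refine Equiv.ext ?_
        rintro (x | e)
        · exact congrArg Sum.inl (by simp)
        · exact congrArg Sum.inr (act.onE_mul g h e) }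
  onEnds :=
    { toFun := fun g => (act.onEnds g).prodCongr (Equiv.refl Bool)
      map_one' := by
        refine Equiv.ext fun c => Prod.ext (act.onEnds_one c.1) rfl
      map_mul' := fun g h => Equiv.ext fun c => Prod.ext (act.onEnds_mul g h c.1) rfl }
  onEnds_flip _ _ := rfl
  endpt_onEnds g c := by
    rcases c with ⟨d, _ | _⟩
    · exact congrArg Sum.inl (act.endpt_onEnds g d)
    · exact congrArg Sum.inr (act.fst_onEnds g d)
  len_onEnds g c := congrArg (· / 2) (act.len_onEnds g c.1)
  boundaryCondition_iff g x a b := by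
    rcases x with x | e
    · refine (Γ.boundaryCondition_oldVertex (act.onV g x) a b).trans
        ((act.boundaryCondition_iff g x _ _).trans
          (Γ.boundaryCondition_oldVertex x (fun c => a (act.onEnds g c.1, c.2))
            fun c => b (act.onEnds g c.1, c.2)).symm)
    · refine (Γ.boundaryCondition_midpoint (act.onE g e) a b).trans
        (Iff.trans ?_ (Γ.boundaryCondition_midpoint e _ _).symm)
      change _ ↔ a (act.onEnds g (e, true), true) = a (act.onEnds g (e, false), true) ∧
        b (act.onEnds g (e, true), true) + b (act.onEnds g (e, false), true) = 0
      have h1 : act.onEnds g (e, true) = MetricGraph.flip (act.onEnds g (e, false)) :=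
        act.onEnds_flip g (e, false)
      have h2 : act.onEnds g (e, false) = (act.onE g e, (act.onEnds g (e, false)).2) := rfl
      rw [h1, h2]
      -- If `g` reverses the edge, it exchanges the two halves, and the midpoint condition is
      -- symmetric in them.
      rcases (act.onEnds g (e, false)).2 with _ | _
      · rfl
      · simp only [MetricGraph.flip, Bool.not_true]
        exact and_congr eq_comm (Iff.of_eq (congrArg (· = 0) (add_comm _ _)))

/-- Every edge joins an old vertex to a midpoint, and the action preserves the two kinds, even when
it reverses edges of `Γ`. -/
theorem noNeighbours_subdivision : act.subdivision.NoNeighbours := fun _ _ h =>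
  Sum.inl_ne_inr h

theorem subdivide_smoothRep (g : G) (f : Γ.Smooth) :
    Γ.subdivide (act.smoothRep g f) = act.subdivision.smoothRep g (Γ.subdivide f) := by
  refine Subtype.ext (funext fun d : Γ.E × Bool => ?_)
  change (Γ.toMetricGraph.subdivision.seg d).indicator (Γ.along (act.transport g f.1) d) =
    (Γ.toMetricGraph.subdivision.seg (act.onEnds g⁻¹ d)).indicator
      (Γ.along f.1 (act.onEnds g⁻¹ d))
  rw [along_transport]
  congr 1
  change Icc 0 (Γ.len _ / 2) = Icc 0 (Γ.len _ / 2)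
  rw [act.len_onEnds]

theorem subdivideH_repH (g : G) (f : Γ.H) :
    Γ.subdivideH (act.repH g f) = act.subdivision.repH g (Γ.subdivideH f) :=
  Subtype.ext (act.subdivide_smoothRep g f.1)

variable {W : Type w} [AddCommGroup W] [Module ℂ W] (R : Representation ℂ G W)

/-- Subdivision does not change the equivariant maps into `H(Γ)`. -/
noncomputable def subdivideHom : act.Hom R ≃ₗ[ℂ] act.subdivision.Hom R where
  toFun f := (Γ.subdivideH.toLinearMap ∘ₗ f.toLinearMap).intertwiningMap_of_isIntertwiningMap
    R act.subdivision.repH fun g r => by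
      refine Eq.trans ?_ (act.subdivideH_repH g (f r))
      exact congrArg Γ.subdivideH (f.isIntertwining _ _ g r)
  invFun f := (Γ.subdivideH.symm.toLinearMap ∘ₗ
    f.toLinearMap).intertwiningMap_of_isIntertwiningMap R act.repH fun g r => by
      refine Γ.subdivideH.symm_apply_eq.2 ?_
      refine (f.isIntertwining _ _ g r).trans (Eq.trans ?_ (act.subdivideH_repH g _).symm)
      exact congrArg _ (Γ.subdivideH.apply_symm_apply (f r)).symm
  map_add' f k := DFunLike.ext _ _ fun r => map_add Γ.subdivideH (f r) (k r)
  map_smul' c f := DFunLike.ext _ _ fun r => map_smul Γ.subdivideH c (f r)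
  left_inv f := DFunLike.ext _ _ fun r => Γ.subdivideH.symm_apply_apply (f r)
  right_inv f := DFunLike.ext _ _ fun r => Γ.subdivideH.apply_symm_apply (f r)

variable {act R}

theorem isQuotient_of_subdivision {Γ' : QuantumGraph.{u}}
    (h : act.subdivision.IsQuotient R Γ') : act.IsQuotient R Γ' := by
  obtain ⟨Ψ⟩ := h
  obtain ⟨Φ, -⟩ := Module.AEval'.exists_equiv (act.homLaplacian R)
    (act.subdivision.homLaplacian R) (act.subdivideHom R) fun f =>
      DFunLike.ext _ _ fun r => Γ.subdivideH_laplacianH (f r)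
  exact ⟨Ψ.trans Φ.symm⟩

theorem IsQuotient.subdivision {Γ' : QuantumGraph.{u}} (h : act.IsQuotient R Γ') :
    act.IsQuotient R Γ'.subdivision := by
  obtain ⟨Ψ⟩ := h
  obtain ⟨Φ, -⟩ := Module.AEval'.exists_equiv Γ'.laplacianH Γ'.subdivision.laplacianH
    Γ'.subdivideH Γ'.subdivideH_laplacianH
  exact ⟨Φ.symm.trans Ψ⟩

end Action

/-! ### Reduction to square matrices -/

theorem _root_.Module.AEval'.nonempty_equiv_restrict {M : Type*} [AddCommGroup M] [Module ℂ M]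
    (T : Module.End ℂ M) {K L : Submodule ℂ M} (h : K = L) (hK : ∀ m ∈ K, T m ∈ K)
    (hL : ∀ m ∈ L, T m ∈ L) :
    Nonempty (Module.AEval' (T.restrict hK) ≃ₗ[ℂ[X]] Module.AEval' (T.restrict hL)) := by
  subst h
  exact ⟨LinearEquiv.refl _ _⟩

/-- Exactness says that the range of `(A | B)` has dimension the degree. Using coordinates on the
range instead of the rows gives matrices of the right size with the same kernel. -/
theorem exists_reduced_matrices (h : Γ.IsExact) (x : Γ.V) :
    ∃ A B : Matrix (Fin (Γ.degree x)) (Γ.EndsAt x) ℂ, ∀ a b : Γ.EndsAt x → ℂ,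
      Matrix.mulVec A a + Matrix.mulVec B b = 0 ↔ (a, b) ∈ Γ.localSpace x := by
  classical
  let L := (Γ.A x).mulVecLin.coprod (Γ.B x).mulVecLin
  have h1 : Module.finrank ℂ (LinearMap.range L) = Module.finrank ℂ (Fin (Γ.degree x) → ℂ) := by
    have h2 := LinearMap.finrank_range_add_finrank_ker L
    have h3 : Module.finrank ℂ (LinearMap.ker L) = Γ.degree x := Γ.isExact_iff.1 h x
    rw [finrank_boundaryData] at h2
    rw [Module.finrank_fin_fun]
    omega
  let φ := LinearEquiv.ofFinrankEq _ _ h1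
  let L' := φ.toLinearMap ∘ₗ L.rangeRestrict
  refine ⟨LinearMap.toMatrix' (L' ∘ₗ LinearMap.inl ℂ _ _),
    LinearMap.toMatrix' (L' ∘ₗ LinearMap.inr ℂ _ _), fun a b => ?_⟩
  rw [LinearMap.toMatrix'_mulVec, LinearMap.toMatrix'_mulVec]
  change L' (LinearMap.inl ℂ _ _ a) + L' (LinearMap.inr ℂ _ _ b) = 0 ↔ _
  rw [← map_add, LinearMap.inl_apply, LinearMap.inr_apply, Prod.mk_add_mk,
    add_zero, zero_add]
  change φ (L.rangeRestrict (a, b)) = 0 ↔ L (a, b) = 0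
  rw [LinearEquiv.map_eq_zero_iff, Subtype.ext_iff]
  rfl

/-- The quantum graph with the same underlying metric graph and other square matrices. -/
noncomputable def replaceMatrices (A B : ∀ x, Matrix (Fin (Γ.degree x)) (Γ.EndsAt x) ℂ) :
    QuantumGraph.{u} where
  toMetricGraph := Γ.toMetricGraph
  Row x := Fin (Γ.degree x)
  finite_Row _ := inferInstance
  A := A
  B := B

section

variable {Γ} {A B : ∀ x, Matrix (Fin (Γ.degree x)) (Γ.EndsAt x) ℂ}
  (h : ∀ x (a b : Γ.EndsAt x → ℂ),
    Matrix.mulVec (A x) a + Matrix.mulVec (B x) b = 0 ↔ (a, b) ∈ Γ.localSpace x)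

include h

theorem isExact_replaceMatrices (hE : Γ.IsExact) : (Γ.replaceMatrices A B).IsExact := by
  refine (isExact_iff _).2 fun x => ?_
  have hloc : (Γ.replaceMatrices A B).localSpace x = Γ.localSpace x :=
    Submodule.ext fun p => h x p.1 p.2
  exact (congrArg (fun K : Submodule ℂ ((Γ.EndsAt x → ℂ) × (Γ.EndsAt x → ℂ)) =>
    Module.finrank ℂ K) hloc).trans (Γ.isExact_iff.1 hE x)

theorem smoothBC_replaceMatrices : (Γ.replaceMatrices A B).SmoothBC = Γ.SmoothBC :=
  Submodule.ext fun _ => forall_congr' fun x => h x _ _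

theorem H_replaceMatrices : (Γ.replaceMatrices A B).H = Γ.H :=
  iSup_congr fun _ => congrArg (· ⊓ _) (smoothBC_replaceMatrices h)

theorem isQuotient_replaceMatrices {G : Type v} [Group G] {Δ : QuantumGraph.{u}}
    {act : Δ.Action G} {W : Type w} [AddCommGroup W] [Module ℂ W] {R : Representation ℂ G W}
    (hq : act.IsQuotient R Γ) : act.IsQuotient R (Γ.replaceMatrices A B) := by
  obtain ⟨Ψ⟩ := hq
  obtain ⟨Φ⟩ := Module.AEval'.nonempty_equiv_restrict Γ.laplacian (H_replaceMatrices h)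
    (Γ.replaceMatrices A B).laplacian_mem_H Γ.laplacian_mem_H
  exact ⟨Φ.trans Ψ⟩

end

/-- A loop in the quotient means that the two end vertices of an edge of `Γ` lie in the same orbit.
-/
theorem Action.Choices.noLoops {Γ : QuantumGraph.{u}} {G : Type v} [Group G] {act : Γ.Action G}
    {W : Type w} [AddCommGroup W] [Module ℂ W] {R : Representation ℂ G W} (C : act.Choices R)
    (hN : act.NoNeighbours) (p : C.metricGraph.E) :
    C.metricGraph.endpt (p, false) ≠ C.metricGraph.endpt (p, true) := by
  intro h
  have h1 : C.repV (Γ.endpt (p.1.1, false)) = C.repV (Γ.endpt (p.1.1, true)) :=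
    congrArg Subtype.val h
  obtain ⟨g, hg⟩ := C.repV_orbit (Γ.endpt (p.1.1, false))
  obtain ⟨k, hk⟩ := C.repV_orbit (Γ.endpt (p.1.1, true))
  apply hN (k * g⁻¹) p.1.1
  rw [← hg, map_mul, Equiv.Perm.mul_apply, map_inv, Equiv.Perm.inv_def, Equiv.symm_apply_apply, h1, hk]

end QuantumGraph

/-! ### Assembly of the theorem -/

theorem theorem4p1 {G : Type v} [Group G] [Finite G] {W : Type w} [AddCommGroup W] [Module ℂ W]
    [FiniteDimensional ℂ W] (R : Representation ℂ G W) (Γ : QuantumGraph.{u})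
    (act : Γ.Action G) :
    (∃ Γ' : QuantumGraph.{u}, Γ'.IsSimple ∧ act.IsQuotient R Γ') ∧
    (Γ.IsProper → Γ.LaplacianIsSelfAdjoint →
      ∃ Γ' : QuantumGraph.{u}, Γ'.IsSimple ∧ act.IsQuotient R Γ' ∧ Γ'.IsProper ∧ Γ'.IsExact) ∧
    (Nonempty (act.Choices R) ∧
      ∀ C : act.Choices R, act.NoNeighbours →
        (∃ Ψ : Module.AEval' (act.homLaplacian R) ≃ₗ[ℂ[X]] Module.AEval' C.graph.laplacianH,
          C.IsEncoding Ψ) ∧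
        (Γ.IsProper → Γ.LaplacianIsSelfAdjoint → C.graph.IsExact)) := by
  -- The graph for the first two claims is the subdivision of the quotient of the subdivision: the
  -- inner one gives the hypothesis on neighbours, the outer one removes parallel edges.
  obtain ⟨C⟩ := act.subdivision.nonempty_choices R
  have hN := act.noNeighbours_subdivision
  have hs : C.graph.subdivision.IsSimple := MetricGraph.isSimple_subdivision (C.noLoops hN)
  have hq : act.IsQuotient R C.graph.subdivision := by
    obtain ⟨Ψ, -⟩ := C.exists_isEncoding hN
    exact (QuantumGraph.Action.isQuotient_of_subdivision ⟨Ψ.symm⟩).subdivision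
  refine ⟨⟨_, hs, hq⟩, fun hP hS => ?_, act.nonempty_choices R, fun C hN =>
    ⟨C.exists_isEncoding hN, fun hP hS => (C.isSplit_graph hN (hS.isSplit hP)).isExact⟩⟩
  -- Being split survives subdivision, quotient and second subdivision, and yields exactness.
  -- Properness is lost in the quotient in general and is restored by reducing the matrices.
  have hE := (QuantumGraph.isSplit_subdivision _
    (C.isSplit_graph hN (Γ.isSplit_subdivision (hS.isSplit hP)))).isExact
  choose A B hAB using QuantumGraph.exists_reduced_matrices _ hE
  exact ⟨C.graph.subdivision.replaceMatrices A B, hs, QuantumGraph.isQuotient_replaceMatrices hAB hq, fun x => Nat.card_fin _,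
    QuantumGraph.isExact_replaceMatrices hAB hE⟩
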